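/- Setting. Let $f(x)=\mathbb E_{\xi\sim P}[\bar f(x;\xi)]$ on $\mathbb R^d$, $d\ge 1$, be bounded below, and suppose that for every $\xi$ the function $\bar f(\cdot;\xi)$ is $L_0$-Lipschitz and $L_1$-smooth, that $\sup_{x,\xi}\mathbb E_{u\sim\mathcal N(0,I_d)}|\bar f(x+tu;\xi)|\le M<\infty$ for all $t\in[0,t_1]$, where $t_1>0$, and that $\mathbb E_\xi\|\nabla_x\bar f(x;\xi)-\nabla f(x)\|^2\le\sigma^2$ for all $x$. Only the values of a measurable function $\bar f'(x;\xi)$ are accessible, where $\sup_x|\bar f(x;\xi)-\bar f'(x;\xi)|\le\nu$ for all $\xi$. Put $f'(x)=\mathbb E_\xi[\bar f'(x;\xi)]$ and $F'(x,t)=\mathbb E_{u\sim\mathcal N(0,I_d)}[f'(x+tu)]$, and let $L_1(t)$ be the gradient-Lipschitz constant of $F'(\cdot,t)$ (the least one, the explicit value $L_1+2\nu/t^2$, or any number between the two, chosen measurably in $t$). Algorithm (error-tolerant stochastic ZOSLGH). Start from $x_1\in\mathbb R^d$ and $t_1$, with a decreasing factor $\gamma\in(0,\bar\gamma]$, where $\bar\gamma<1$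 is a constant, and $\eta\in\mathbb R$. For $k=1,\dots,T$ draw independent $\xi_k\sim P$ and $u_k,v_k\sim\mathcal N(0,I_d)$ and set $$x_{k+1}=x_k-\beta_k\,\frac{\bar f'(x_k+t_ku_k;\xi_k)-\bar f'(x_k;\xi_k)}{t_k}\,u_k,$$ and either $t_{k+1}=\max\{\gamma t_k,\sqrt\nu\}$ (ratio rule), or $t_{k+1}=\max\{\min\{t_k-\eta G_k,\gamma t_k\},\sqrt\nu\}$ with $G_k=(\|v_k\|^2-d)\,(\bar f'(x_k+t_kv_k;\xi_k)-\bar f'(x_k;\xi_k))/t_k^2$ (derivative rule). Here $\nu\ge0$, and $\nu>0$ for the derivative rule. The step sizes are $$\beta_k=\min\Big\{\frac1{16(d+4)L_1(t_k)},\frac1{\sqrt{(T-k_0)(d+4)}}\Big\},\qquad k_0=\min\{k_1,k_2\},$$ with $1/0=\infty$, where $k_1,k_2$ are nonnegative integers and $a_1 d/\epsilon^4\le k_1\le a_2 d/\epsilon^4$ with constants $a_1,a_2>0$. The output is $\hat x=x_{k'}$, where $k'$ is uniform on $\{k_0+1,\dots,T\}$ and independent of the samples. Theorem. Let $b>0$.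 There are constants $c,C>0$, depending only on $M,L_0,L_1,\sigma,t_1,\bar\gamma,a_1,a_2,b$ (and not on $d,\epsilon,\gamma,\eta,\nu,x_1$, the functions or $P$), such that for every $\epsilon>0$ and every error level $\nu\le c\,\epsilon^2/d^3$, for either update rule: (1) for every $\gamma\in(0,\bar\gamma]$ and every $k_2$ (in particular for every $k_2=O(\log_\gamma(1/d))$), $\mathbb E\|\nabla f(\hat x)\|\le\epsilon$ for every $T\ge C\,(d^2/\epsilon^4+d^3/\epsilon^2)$; thus the iteration complexity is $T=O(d^2/\epsilon^4+d^3/\epsilon^2)$; (2) if moreover $\gamma\le d^{-b\,\epsilon^4/d}$, $a_1\ge 1/b$ and $k_2\ge\log_\gamma(1/d)$, then $\mathbb E\|\nabla f(\hat x)\|\le\epsilon$ for every $T\ge C\,d/\epsilon^4$; thus the iteration complexity is $T=O(d/\epsilon^4)$. The expectation is over $\{u_k\},\{v_k\},\{\xi_k\}$ and $k'$. -/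

import Mathlib

open MeasureTheory ProbabilityTheory

namespace ZOSLGH

/-- `ℝ^d` with the Euclidean norm. -/
abbrev E (d : ℕ) : Type := EuclideanSpace ℝ (Fin d)

/-- `h` is Lipschitz with constant `L`. -/
def IsLip {d : ℕ} (L : ℝ) (h : E d → ℝ) : Prop :=
  ∀ x y, |h x - h y| ≤ L * ‖x - y‖

/-- `h` is `L`-smooth: differentiable with `L`-Lipschitz gradient. -/
def IsSmooth {d : ℕ} (L : ℝ) (h : E d → ℝ) : Prop :=
  Differentiable ℝ h ∧ ∀ x y, ‖gradient h x - gradient h y‖ ≤ L * ‖x - y‖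

/-- The gradient-Lipschitz constant of `h`: the least `L ≥ 0` such that `h` is `L`-smooth. -/
noncomputable def gradLip {d : ℕ} (h : E d → ℝ) : ℝ :=
  sInf {L : ℝ | 0 ≤ L ∧ IsSmooth L h}

/-- Gaussian smoothing `H(x,t) = 𝔼[h(x + t u)]`, `u ∼ N(0, I_d)`. -/
noncomputable def smoothed {d : ℕ} (h : E d → ℝ) (x : E d) (t : ℝ) : ℝ :=
  ∫ u, h (x + t • u) ∂(stdGaussian (E d))

/-- Mean of a stochastic function, `x ↦ 𝔼_{ξ ∼ P}[g(x; ξ)]`. -/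
noncomputable def meanFn {d : ℕ} {Ξ : Type*} [MeasurableSpace Ξ] (P : Measure Ξ)
    (g : E d → Ξ → ℝ) (x : E d) : ℝ :=
  ∫ s, g x s ∂P

/-- Standing assumptions on the objective `f` and its stochastic function `fbar`: the
Gaussian averages of `|fbar(·; ξ)|` are bounded by `M` for every smoothing parameter in
`[0, t₁]`, the minimisation problem has a finite optimal value, and every `fbar(·; ξ)` is
`L₀`-Lipschitz and `L₁`-smooth. -/
structure RegularObjective {d : ℕ} {Ξ : Type*} [MeasurableSpace Ξ]
    (M L₀ L₁ t₁ : ℝ) (f : E d → ℝ) (fbar : E d → Ξ → ℝ) : Prop where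
  measurable : ∀ x, Measurable (fbar x)
  bounded : ∀ t ∈ Set.Icc (0 : ℝ) t₁, ∀ x s,
    ∫ u, |fbar (x + t • u) s| ∂(stdGaussian (E d)) ≤ M
  bddBelow : BddBelow (Set.range f)
  lip : ∀ s, IsLip L₀ (fun x => fbar x s)
  smooth : ∀ s, IsSmooth L₁ (fun x => fbar x s)

/-- `fbar(·; ξ)` is an unbiased estimator of `f` and its gradient has variance at most `σ²`. -/
structure StochasticOracle {d : ℕ} {Ξ : Type*} [MeasurableSpace Ξ] (P : Measure Ξ)
    (σ : ℝ) (f : E d → ℝ) (fbar : E d → Ξ → ℝ) : Prop where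
  unbiased : ∀ x, f x = meanFn P fbar x
  variance : ∀ x, ∫ s, ‖gradient (fun y => fbar y s) x - gradient f x‖ ^ 2 ∂P ≤ σ ^ 2

/-- The accessible function `fbar'` differs from `fbar` by at most `ν`, uniformly in the point
and in the sample; nothing else is assumed of it (beyond measurability). -/
structure ErrorBound {d : ℕ} {Ξ : Type*} [MeasurableSpace Ξ]
    (ν : ℝ) (fbar fbar' : E d → Ξ → ℝ) : Prop where
  measurable : Measurable (Function.uncurry fbar')
  close : ∀ x s, |fbar x s - fbar' x s| ≤ ν

/-- The two update rules for `t`: fixed ratio, or with derivative information. -/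
inductive Rule where
  | ratio : Rule
  | derivative : Rule

/-- Zeroth-order gradient estimator `(g(x+tu; ξ) - g(x; ξ)) / t · u`. -/
noncomputable def gradEst {d : ℕ} {Ξ : Type*} (g : E d → Ξ → ℝ) (x : E d) (t : ℝ)
    (s : Ξ) (u : E d) : E d :=
  ((g (x + t • u) s - g x s) / t) • u

/-- Zeroth-order estimator `(vᵀv - d)(g(x+tv; ξ) - g(x; ξ)) / t²` of the derivative in `t`. -/
noncomputable def derivEst {d : ℕ} {Ξ : Type*} (g : E d → Ξ → ℝ) (x : E d) (t : ℝ)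
    (s : Ξ) (v : E d) : ℝ :=
  (‖v‖ ^ 2 - d) * (g (x + t • v) s - g x s) / t ^ 2

/-- The step size `min {1 / (16(d+4)ℓ), 1 / √(N(d+4))}`, written as the reciprocal of a maximum
so that it has its usual meaning (`1/0 = ∞`) when `ℓ = 0`. Here `N` stands for `T - k₀`. -/
noncomputable def stepSize (d : ℕ) (ℓ N : ℝ) : ℝ :=
  1 / max (16 * (d + 4) * ℓ) (Real.sqrt (N * (d + 4)))

theorem stepSize_eq_min (d : ℕ) {ℓ N : ℝ} (hℓ : 0 < ℓ) (hN : 0 < N) :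
    stepSize d ℓ N =
      min (1 / (16 * (d + 4) * ℓ)) (1 / Real.sqrt (N * (d + 4))) := by
  have h1 : (0 : ℝ) < 16 * (d + 4) * ℓ := by positivity
  have h2 : 0 < Real.sqrt (N * (d + 4)) := by positivity
  unfold stepSize
  rcases le_total (16 * (d + 4) * ℓ) (Real.sqrt (N * (d + 4))) with h | h
  · rw [max_eq_right h, min_eq_right (one_div_le_one_div_of_le h1 h)]
  · rw [max_eq_left h, min_eq_left (one_div_le_one_div_of_le h2 h)]

/-- The update of `t`, given the value `G` of the derivative estimator. -/
noncomputable def nextT (rule : Rule) (γ η ν t G : ℝ) : ℝ :=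
  match rule with
  | Rule.ratio => max (γ * t) (Real.sqrt ν)
  | Rule.derivative => max (min (t - η * G) (γ * t)) (Real.sqrt ν)

/-- The pair `(x_{n+1}, t_{n+1})`, i.e. the state after `n` iterations. Iteration `k = 1, 2, …`
uses the sample `z k = (ξ_k, u_k, v_k)` and, at smoothing parameter `t`, step size `β t`. -/
noncomputable def state {d : ℕ} {Ξ : Type*} (rule : Rule) (g : E d → Ξ → ℝ)
    (β : ℝ → ℝ) (γ η ν : ℝ) (x₁ : E d) (t₁ : ℝ) (z : ℕ → Ξ × E d × E d) : ℕ → E d × ℝ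
  | 0 => (x₁, t₁)
  | n + 1 =>
    let p := state rule g β γ η ν x₁ t₁ z n
    let s := (z (n + 1)).1
    let u := (z (n + 1)).2.1
    let v := (z (n + 1)).2.2
    (p.1 - β p.2 • gradEst g p.1 p.2 s u,
      nextT rule γ η ν p.2 (derivEst g p.1 p.2 s v))

/-- The iterate `x_k`, `k = 1, 2, …`. -/
noncomputable def iterate {d : ℕ} {Ξ : Type*} (rule : Rule) (g : E d → Ξ → ℝ)
    (β : ℝ → ℝ) (γ η ν : ℝ) (x₁ : E d) (t₁ : ℝ) (z : ℕ → Ξ × E d × E d) (k : ℕ) : E d :=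
  (state rule g β γ η ν x₁ t₁ z (k - 1)).1

/-- The randomness of the algorithm: the samples `(ξ_k, u_k, v_k)` are i.i.d. with law
`P ⊗ N(0, I_d) ⊗ N(0, I_d)`, and the output index `κ` is uniform on `{k₀+1, …, T}` and
independent of all of them. -/
structure Sampling {d : ℕ} {Ξ Ω : Type*} [MeasurableSpace Ξ] [MeasurableSpace Ω]
    (P : Measure Ξ) (μ : Measure Ω) (ζ : ℕ → Ω → Ξ × E d × E d) (k₀ T : ℕ) (κ : Ω → ℕ) :
    Prop where
  measurable : ∀ k, Measurable (ζ k)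
  law : ∀ k, μ.map (ζ k) = P.prod ((stdGaussian (E d)).prod (stdGaussian (E d)))
  indep : iIndepFun ζ μ
  measurable_index : Measurable κ
  law_index : μ.map κ = uniformOn (Set.Icc (k₀ + 1) T)
  indep_index : IndepFun κ (fun ω k => ζ k ω) μ

/-- `𝔼‖∇f(x̂)‖ ≤ ε` for the random point `xhat`, the expectation being a genuine one. -/
def ReachesTolerance {d : ℕ} {Ω : Type*} [MeasurableSpace Ω] (μ : Measure Ω)
    (f : E d → ℝ) (xhat : Ω → E d) (ε : ℝ) : Prop :=
  Integrable (fun ω => ‖gradient f (xhat ω)‖) μ ∧ ∫ ω, ‖gradient f (xhat ω)‖ ∂μ ≤ ε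

end ZOSLGH

namespace ZOSLGH

open scoped RealInnerProductSpace

/-! The proof is a stochastic descent argument for `f` itself. Gaussian smoothing enters only
through the step size.

Taylor's formula compares the two-point quotient along `u` with `⟪∇f, u⟫`. The error is at most `L₁
t ‖u‖²` from curvature plus `2ν/t ≤ 2√ν` from the inexact values, because the floor in the update of
`t` keeps `√ν ≤ t`. Sixth moments turn this into a mean square error `errBound` of order `d³t² +
dν`, and Young's inequality absorbs its effect on the descent term into half of `‖∇f‖²`
(`le_integral_diffQuot_mul_inner`). The second moment of the estimator is of order `d L₀²` plus the
same error (`integral_diffQuot_sq_mul_le`). Together these give the one-step descent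
`integral_step_le`.

The smoothing parameter is random under the derivative rule, but both rules satisfy `√ν ≤ t ≤ max
(γⁿ t₁) √ν` deterministically (`state_snd_bounds`). The step size stays within constant factors of
`1/√(N(d+4))`, with `N = T - k₀`: the gradient-Lipschitz constant of the smoothed function is at
most `L₁ + 2ν/t² ≤ L₁ + 2`, free of the dimension. That bound rests on Cameron–Martin and the
semigroup property of Gaussian smoothing.

Telescoping over the window, with `|f| ≤ M`, bounds the mean square gradient at the output by a
constant times `√(d/N) + d³γ^(2k₀)/N + d³ν`. The first term needs `N` of order `d/ε⁴`, and the last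
is the condition on `ν`. The middle term costs `d³/ε²` when only `γ^k₀ ≤ 1` is known, and is
harmless once `γ^k₀ ≤ 1/d`. -/

/-- The standard Gaussian measure on `ℝ^d`. -/
noncomputable abbrev gauss (d : ℕ) : Measure (E d) := stdGaussian (E d)

/-- The `n`-th moment of the standard normal distribution. -/
noncomputable def normalMoment (n : ℕ) : ℝ := ∫ y, y ^ n ∂(gaussianReal 0 1)

/-! ### Polynomial moments of the standard Gaussian -/

variable {d : ℕ}

theorem map_inner_gauss (a : E d) :
    (gauss d).map (fun u => ⟪a, u⟫) = (gaussianReal 0 1).map (fun y => ‖a‖ * y) := by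
  have h := IsGaussian.map_eq_gaussianReal (μ := gauss d) (innerSL ℝ a)
  have h1 := integral_strongDual_stdGaussian (innerSL ℝ a)
  rw [h1, variance_dual_stdGaussian, innerSL_apply_norm] at h
  rw [gaussianReal_map_const_mul]
  simp only [mul_zero, mul_one]
  have e : (fun u => ⟪a, u⟫) = ⇑(innerSL ℝ a) := by
    ext
    simp
  rw [e, h, Real.toNNReal_of_nonneg (sq_nonneg ‖a‖)]

theorem integrable_comp_inner {φ : ℝ → ℝ} (hφ : Continuous φ) (a : E d)
    (h : Integrable (fun y => φ (‖a‖ * y)) (gaussianReal 0 1)) :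
    Integrable (fun u => φ ⟪a, u⟫) (gauss d) := by
  have h1 : Integrable φ ((gaussianReal 0 1).map (fun y => ‖a‖ * y)) := by
    rw [integrable_map_measure hφ.aestronglyMeasurable (by fun_prop)]
    exact h
  rw [← map_inner_gauss, integrable_map_measure hφ.aestronglyMeasurable (by fun_prop)] at h1
  exact h1

theorem integral_comp_inner {φ : ℝ → ℝ} (hφ : Continuous φ) (a : E d) :
    ∫ u, φ ⟪a, u⟫ ∂(gauss d) = ∫ y, φ (‖a‖ * y) ∂(gaussianReal 0 1) := by
  rw [← integral_map (φ := fun u => ⟪a, u⟫) (by fun_prop) hφ.aestronglyMeasurable,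
    map_inner_gauss, integral_map (by fun_prop) hφ.aestronglyMeasurable]

theorem integrable_norm_pow (n : ℕ) : Integrable (fun u : E d => ‖u‖ ^ n) (gauss d) := by
  rcases Nat.eq_zero_or_pos n with rfl | hn
  · simp
  · have := (IsGaussian.memLp_id (gauss d) (n : ENNReal) (by simp)).integrable_norm_pow
      (by omega)
    simpa using this

theorem integrable_inner_pow (a : E d) (n : ℕ) :
    Integrable (fun u : E d => ⟪a, u⟫ ^ n) (gauss d) := by
  refine ((integrable_norm_pow n).const_mul (‖a‖ ^ n)).mono' (by fun_prop) (ae_of_all _ fun u => ?_)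
  rw [norm_pow, ← mul_pow]
  exact pow_le_pow_left₀ (norm_nonneg _) (norm_inner_le_norm a u) n

theorem integral_inner_pow (a : E d) (n : ℕ) :
    ∫ u, ⟪a, u⟫ ^ n ∂(gauss d) = ‖a‖ ^ n * normalMoment n := by
  rw [integral_comp_inner (φ := fun y => y ^ n) (by fun_prop), normalMoment,
    ← integral_const_mul]
  simp [mul_pow]

theorem normalMoment_two : normalMoment 2 = 1 := by
  have h := variance_of_integral_eq_zero (μ := gaussianReal 0 1) (X := id) (by fun_prop) (by simp)
  rw [variance_id_gaussianReal] at h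
  simpa [normalMoment] using h.symm

theorem normalMoment_nonneg (n : ℕ) (hn : Even n) : 0 ≤ normalMoment n :=
  integral_nonneg fun y => hn.pow_nonneg y

theorem integral_inner_sq (a : E d) : ∫ u, ⟪a, u⟫ ^ 2 ∂(gauss d) = ‖a‖ ^ 2 := by
  rw [integral_inner_pow, normalMoment_two, mul_one]

theorem coord_eq_inner (u : E d) (i : Fin d) :
    u i = ⟪EuclideanSpace.single i (1 : ℝ), u⟫ := by
  simp [EuclideanSpace.inner_single_left]

theorem integrable_coord_pow (i : Fin d) (n : ℕ) :
    Integrable (fun u : E d => u i ^ n) (gauss d) := by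
  simp_rw [coord_eq_inner]
  exact integrable_inner_pow _ n

theorem integral_coord_pow (i : Fin d) (n : ℕ) :
    ∫ u : E d, u i ^ n ∂(gauss d) = normalMoment n := by
  simp_rw [coord_eq_inner]
  rw [integral_inner_pow]
  simp

theorem integral_norm_sq : ∫ u : E d, ‖u‖ ^ 2 ∂(gauss d) = d := by
  simp_rw [EuclideanSpace.real_norm_sq_eq]
  rw [integral_finsetSum _ fun i _ => integrable_coord_pow i 2]
  simp [integral_coord_pow, normalMoment_two]

/-- The power mean inequality for the squared coordinates gives `‖u‖⁶ ≤ d² ∑ uᵢ⁶`, which has the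
right order in `d` and needs only a one-dimensional moment. -/
theorem integral_norm_pow_six_le (hd : 0 < d) :
    ∫ u : E d, ‖u‖ ^ 6 ∂(gauss d) ≤ normalMoment 6 * d ^ 3 := by
  have hd' : (0 : ℝ) < d := by exact_mod_cast hd
  calc ∫ u : E d, ‖u‖ ^ 6 ∂(gauss d)
      ≤ ∫ u : E d, (d : ℝ) ^ 2 * ∑ i, u i ^ 6 ∂(gauss d) := by
        refine integral_mono (integrable_norm_pow 6)
          ((integrable_finsetSum _ fun i _ => integrable_coord_pow i 6).const_mul _) fun u => ?_
        have h := pow_sum_div_card_le_sum_pow (s := Finset.univ) (f := fun i => u i ^ 2)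
          (fun i _ => sq_nonneg _) 2
        rw [← EuclideanSpace.real_norm_sq_eq, div_le_iff₀ (by simp; positivity)] at h
        simp only [Finset.card_univ, Fintype.card_fin, ← pow_mul] at h
        norm_num at h
        change ‖u‖ ^ 6 ≤ _
        rw [mul_comm]
        exact h
    _ = normalMoment 6 * d ^ 3 := by
        rw [integral_const_mul, integral_finsetSum _ fun i _ => integrable_coord_pow i 6]
        simp only [integral_coord_pow, Finset.sum_const, Finset.card_univ, Fintype.card_fin,
          nsmul_eq_mul]
        ring

theorem integrable_inner_sq_mul_norm_sq (a : E d) :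
    Integrable (fun u : E d => ⟪a, u⟫ ^ 2 * ‖u‖ ^ 2) (gauss d) := by
  refine ((integrable_norm_pow 4).const_mul (‖a‖ ^ 2)).mono' (by fun_prop)
    (ae_of_all _ fun u => ?_)
  have h : ⟪a, u⟫ ^ 2 ≤ (‖a‖ * ‖u‖) ^ 2 :=
    sq_le_sq' (neg_le_of_abs_le (abs_real_inner_le_norm a u)) (real_inner_le_norm a u)
  rw [Real.norm_of_nonneg (by positivity)]
  nlinarith [mul_le_mul_of_nonneg_right h (sq_nonneg ‖u‖)]

/-- Young's inequality, coordinate by coordinate, replaces the joint moment of `⟪a, u⟫` and `uᵢ` by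
two separate fourth moments. The weights `‖a‖^(±2)` make their contributions equal. -/
theorem integral_inner_sq_mul_norm_sq_le (a : E d) :
    ∫ u : E d, ⟪a, u⟫ ^ 2 * ‖u‖ ^ 2 ∂(gauss d) ≤ normalMoment 4 * d * ‖a‖ ^ 2 := by
  rcases eq_or_ne a 0 with rfl | ha
  · simp
  have ha' : 0 < ‖a‖ ^ 2 := by positivity
  have hi : ∀ i : Fin d, Integrable
      (fun u : E d => (⟪a, u⟫ ^ 4 / ‖a‖ ^ 2 + ‖a‖ ^ 2 * u i ^ 4) / 2) (gauss d) := fun i =>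
    (((integrable_inner_pow a 4).div_const _).add
      ((integrable_coord_pow i 4).const_mul _)).div_const _
  calc ∫ u : E d, ⟪a, u⟫ ^ 2 * ‖u‖ ^ 2 ∂(gauss d)
      ≤ ∫ u : E d, ∑ i, (⟪a, u⟫ ^ 4 / ‖a‖ ^ 2 + ‖a‖ ^ 2 * u i ^ 4) / 2 ∂(gauss d) := by
        refine integral_mono (integrable_inner_sq_mul_norm_sq a)
          (integrable_finsetSum _ fun i _ => hi i) fun u => ?_
        simp only [EuclideanSpace.real_norm_sq_eq u, Finset.mul_sum]
        refine Finset.sum_le_sum fun i _ => ?_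
        have h : ⟪a, u⟫ ^ 4 / ‖a‖ ^ 2 + ‖a‖ ^ 2 * u i ^ 4 - 2 * (⟪a, u⟫ ^ 2 * u i ^ 2)
            = (⟪a, u⟫ ^ 2 - ‖a‖ ^ 2 * u i ^ 2) ^ 2 / ‖a‖ ^ 2 := by
          field_simp
          ring
        have : 0 ≤ (⟪a, u⟫ ^ 2 - ‖a‖ ^ 2 * u i ^ 2) ^ 2 / ‖a‖ ^ 2 := by positivity
        linarith
    _ = normalMoment 4 * d * ‖a‖ ^ 2 := by
        rw [integral_finsetSum _ fun i _ => hi i]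
        have : ∀ i : Fin d, ∫ u : E d, (⟪a, u⟫ ^ 4 / ‖a‖ ^ 2 + ‖a‖ ^ 2 * u i ^ 4) / 2 ∂(gauss d)
            = normalMoment 4 * ‖a‖ ^ 2 := by
          intro i
          rw [integral_div, integral_add ((integrable_inner_pow a 4).div_const _)
            ((integrable_coord_pow i 4).const_mul _), integral_div, integral_const_mul,
            integral_inner_pow, integral_coord_pow]
          field_simp
          ring
        simp only [this, Finset.sum_const, Finset.card_univ, Fintype.card_fin, nsmul_eq_mul]
        ring

/-! ### Exponential moments, translation and rotation of the Gaussian -/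

theorem integrable_exp_inner (a : E d) : Integrable (fun u => Real.exp ⟪a, u⟫) (gauss d) :=
  integrable_comp_inner Real.continuous_exp a (integrable_exp_mul_gaussianReal ‖a‖)

theorem integral_exp_inner (a : E d) :
    ∫ u, Real.exp ⟪a, u⟫ ∂(gauss d) = Real.exp (‖a‖ ^ 2 / 2) := by
  rw [integral_comp_inner Real.continuous_exp]
  have := congrFun (mgf_id_gaussianReal (μ := 0) (v := 1)) ‖a‖
  simpa [mgf] using this

theorem integrable_exp_norm (c : ℝ) : Integrable (fun u => Real.exp (c * ‖u‖)) (gauss d) := by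
  obtain ⟨C, hC, h⟩ := IsGaussian.exists_integrable_exp_sq (gauss d)
  refine (h.const_mul (Real.exp (c ^ 2 / (4 * C)))).mono' (by fun_prop) (ae_of_all _ fun u => ?_)
  rw [Real.norm_of_nonneg (Real.exp_nonneg _), ← Real.exp_add]
  refine Real.exp_le_exp.2 ?_
  have : c ^ 2 / (4 * C) + C * ‖u‖ ^ 2 - c * ‖u‖ = (2 * C * ‖u‖ - c) ^ 2 / (4 * C) := by
    field_simp
    ring
  have : 0 ≤ (2 * C * ‖u‖ - c) ^ 2 / (4 * C) := by positivity
  linarith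

/-- The **Cameron–Martin formula** for the standard Gaussian measure. -/
theorem gauss_map_add (a : E d) :
    (gauss d).map (fun u => u + a) = (gauss d).tilted (fun u => ⟪a, u⟫) := by
  have := isProbabilityMeasure_tilted (integrable_exp_inner a)
  have : IsProbabilityMeasure ((gauss d).map (fun u => u + a)) :=
    Measure.isProbabilityMeasure_map (by fun_prop)
  have key : ∀ (w : E d) (s : ℝ) (u : E d),
      Real.exp ⟪a, u⟫ * Real.exp (s * ⟪u, w⟫) = Real.exp ⟪a + s • w, u⟫ := by
    intro w s u
    rw [← Real.exp_add, inner_add_left, real_inner_smul_left, real_inner_comm u w]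
  refine Measure.ext_of_charFun (funext fun w => ?_)
  have hX : integrableExpSet (fun u => ⟪u, w⟫) ((gauss d).tilted (fun u => ⟪a, u⟫))
      = Set.univ := by
    refine Set.eq_univ_of_forall fun s => ?_
    change Integrable _ _
    rw [integrable_tilted_iff (integrable_exp_inner a)]
    simp only [smul_eq_mul, key]
    exact integrable_exp_inner _
  have hm : mgf (fun u => ⟪u, w⟫) ((gauss d).tilted (fun u => ⟪a, u⟫))
      = mgf (fun u => ⟪u, w⟫) ((gauss d).map (fun u => u + a)) := by
    funext s
    rw [mgf, mgf, integral_tilted, integral_map (by fun_prop) (by fun_prop)]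
    simp only [smul_eq_mul, div_mul_eq_mul_div, key]
    simp only [inner_add_left (𝕜 := ℝ) _ a w, mul_add, Real.exp_add]
    rw [integral_div, integral_mul_const, integral_exp_inner]
    have h2 : ∀ u : E d, Real.exp (s * ⟪u, w⟫) = Real.exp ⟪s • w, u⟫ := by
      intro u
      rw [real_inner_smul_left, real_inner_comm]
    simp only [h2]
    rw [integral_exp_inner, integral_exp_inner, div_eq_iff (Real.exp_ne_zero _),
      ← Real.exp_add, ← Real.exp_add, norm_add_sq_real, real_inner_smul_left, real_inner_smul_right,
      norm_smul, real_inner_comm w a]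
    ring_nf
  -- The real moment generating functions agree and are finite everywhere, so their analytic
  -- extensions agree. The value at `I` is the characteristic function.
  have h := eqOn_complexMGF_of_mgf hm (x := Complex.I) (by simp [hX])
  simp only [complexMGF, charFun_apply] at h ⊢
  simpa [mul_comm] using h.symm

/-- Moves a translation off `h` onto a smooth weight, so that smoothings of merely measurable
functions can be differentiated. -/
theorem integral_gauss_add (a : E d) (h : E d → ℝ) :
    ∫ u, h (u + a) ∂(gauss d)
      = ∫ u, Real.exp (⟪a, u⟫ - ‖a‖ ^ 2 / 2) * h u ∂(gauss d) := by
  have he : MeasurableEmbedding (fun u : E d => u + a) :=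
    (Homeomorph.addRight a).measurableEmbedding
  rw [← he.integral_map, gauss_map_add, integral_tilted]
  simp only [integral_exp_inner, Real.exp_sub, smul_eq_mul]

/-- First marginal of the rotation of the product measure by `π/4`; it splits one smoothing into two
of half the variance. -/
theorem gauss_prod_map :
    ((gauss d).prod (gauss d)).map (fun p => (√2 / 2) • p.1 + (√2 / 2) • p.2) = gauss d := by
  have h := IsGaussian.map_rotation_eq_self_of_forall_strongDual_eq_zero (μ := gauss d)
    (fun L => integral_strongDual_stdGaussian L) (Real.pi / 4)
  have h2 := congrArg (Measure.map Prod.fst) h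
  rw [Measure.map_map (by fun_prop) (by fun_prop), Measure.map_fst_prod] at h2
  simpa [Function.comp_def, ContinuousLinearMap.rotation_apply] using h2

/-! ### Smoothing a bounded measurable function -/

theorem integrable_norm_gauss : Integrable (fun u : E d => ‖u‖) (gauss d) := by
  simpa using integrable_norm_pow (d := d) 1

theorem integrable_smul_self {k : E d → ℝ} {B : ℝ} (hk : Measurable k) (hB : ∀ u, |k u| ≤ B) :
    Integrable (fun u => k u • u) (gauss d) := by
  refine (integrable_norm_gauss.const_mul B).mono' (by fun_prop) (ae_of_all _ fun u => ?_)
  rw [norm_smul, Real.norm_eq_abs]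
  exact mul_le_mul_of_nonneg_right (hB u) (norm_nonneg _)

/-- Paired with itself, the vector `G` only sees the direction `G`, where `𝔼|⟪G, u⟫| ≤ ‖G‖`; hence
no factor of `d`. -/
theorem norm_integral_smul_self_le {k : E d → ℝ} {B : ℝ} (hk : Measurable k)
    (hB : ∀ u, |k u| ≤ B) : ‖∫ u, k u • u ∂(gauss d)‖ ≤ B := by
  set G := ∫ u, k u • u ∂(gauss d) with hG
  have hB0 : 0 ≤ B := (abs_nonneg _).trans (hB 0)
  rcases eq_or_ne G 0 with h0 | h0
  · simpa [h0] using hB0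
  have hn : 0 < ‖G‖ := norm_pos_iff.2 h0
  have h1 : ‖G‖ ^ 2 ≤ B * ‖G‖ :=
    calc ‖G‖ ^ 2 = ∫ u, k u * ⟪G, u⟫ ∂(gauss d) := by
          rw [← real_inner_self_eq_norm_sq]
          nth_rw 2 [hG]
          rw [← integral_inner (integrable_smul_self hk hB)]
          simp only [real_inner_smul_right]
      _ ≤ ∫ u, B * ((⟪G, u⟫ ^ 2 / ‖G‖ + ‖G‖) / 2) ∂(gauss d) := by
          refine integral_mono ?_ ((((integrable_inner_pow G 2).div_const _).add
            (integrable_const _)).div_const _ |>.const_mul _) fun u => ?_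
          · simpa only [real_inner_smul_right] using (integrable_smul_self hk hB).const_inner (𝕜 := ℝ) G
          -- Young's inequality stands in for Cauchy–Schwarz; both halves have mean `‖G‖`.
          · have h2 : |⟪G, u⟫| ≤ (⟪G, u⟫ ^ 2 / ‖G‖ + ‖G‖) / 2 := by
              rw [← sq_abs ⟪G, u⟫, le_div_iff₀ two_pos, ← sub_nonneg]
              have : |⟪G, u⟫| ^ 2 / ‖G‖ + ‖G‖ - |⟪G, u⟫| * 2 = (|⟪G, u⟫| - ‖G‖) ^ 2 / ‖G‖ := by
                field_simp
                ring
              rw [this]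
              positivity
            calc k u * ⟪G, u⟫ ≤ |k u| * |⟪G, u⟫| := by rw [← abs_mul]; exact le_abs_self _
              _ ≤ _ := mul_le_mul (hB u) h2 (abs_nonneg _) hB0
      _ = B * ‖G‖ := by
          rw [integral_const_mul, integral_div, integral_add
            ((integrable_inner_pow G 2).div_const _) (integrable_const _), integral_div,
            integral_inner_sq, integral_const, probReal_univ, one_smul, sq, mul_div_assoc,
            div_self hn.ne']
          ring
  nlinarith


theorem hasGradientAt_smoothed {h : E d → ℝ} {B t : ℝ} (hh : Measurable h)
    (hB : ∀ x, |h x| ≤ B) (ht : 0 < t) (x : E d) :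
    HasGradientAt (fun y => smoothed h y t) (t⁻¹ • ∫ u, h (x + t • u) • u ∂(gauss d)) x := by
  have hm : Measurable fun u => h (x + t • u) := hh.comp (by fun_prop)
  have hB0 : 0 ≤ B := (abs_nonneg _).trans (hB 0)
  let F : E d → E d → ℝ := fun α u => Real.exp (⟪α, u⟫ - ‖α‖ ^ 2 / 2) * h (x + t • u)
  let F' : E d → E d → E d →L[ℝ] ℝ := fun α u =>
    (Real.exp (⟪α, u⟫ - ‖α‖ ^ 2 / 2) * h (x + t • u)) • (innerSL ℝ u - innerSL ℝ α)
  have hexp : ∀ α u : E d, α ∈ Metric.ball (0 : E d) 1 →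
      Real.exp (⟪α, u⟫ - ‖α‖ ^ 2 / 2) ≤ Real.exp (1 * ‖u‖) := by
    intro α u hα
    rw [mem_ball_zero_iff] at hα
    refine Real.exp_le_exp.2 ?_
    have := real_inner_le_norm α u
    nlinarith [norm_nonneg u, sq_nonneg ‖α‖]
  -- Only the Cameron–Martin weight depends on `α`. On the unit ball the weight and the factor `‖u -
  -- α‖` are each at most `exp ‖u‖`, whence the dominating function.
  have hF : HasFDerivAt (fun α => ∫ u, F α u ∂(gauss d)) (∫ u, F' 0 u ∂(gauss d)) 0 := by
    refine hasFDerivAt_integral_of_dominated_of_fderiv_le (s := Metric.ball 0 1)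
      (bound := fun u => B * Real.exp (2 * ‖u‖))
      (Metric.ball_mem_nhds 0 one_pos) (.of_forall fun α => ?_) ?_ ?_
      (ae_of_all _ fun u α hα => ?_) ((integrable_exp_norm 2).const_mul B)
      (ae_of_all _ fun u α _ => ?_)
    · exact Measurable.aestronglyMeasurable (by fun_prop)
    · refine Integrable.mono' (integrable_const B) (Measurable.aestronglyMeasurable (by fun_prop))
        (ae_of_all _ fun u => ?_)
      simpa [F] using hB (x + t • u)
    · have h1 : Measurable fun u : E d => Real.exp (⟪(0 : E d), u⟫ - ‖(0 : E d)‖ ^ 2 / 2)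
          * h (x + t • u) := by fun_prop
      have h2 : Continuous fun u : E d => innerSL ℝ u - innerSL ℝ (0 : E d) := by fun_prop
      exact h1.aestronglyMeasurable.smul h2.aestronglyMeasurable
    · have h1 : ‖innerSL ℝ u - innerSL ℝ α‖ ≤ Real.exp ‖u‖ := by
        rw [mem_ball_zero_iff] at hα
        calc ‖innerSL ℝ u - innerSL ℝ α‖ ≤ ‖innerSL ℝ u‖ + ‖innerSL ℝ α‖ := norm_sub_le _ _
          _ ≤ ‖u‖ + 1 := by
            rw [innerSL_apply_norm, innerSL_apply_norm]
            linarith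
          _ ≤ Real.exp ‖u‖ := Real.add_one_le_exp _
      simp only [F', norm_smul, norm_mul, Real.norm_eq_abs, Real.abs_exp]
      calc Real.exp (⟪α, u⟫ - ‖α‖ ^ 2 / 2) * |h (x + t • u)| * ‖innerSL ℝ u - innerSL ℝ α‖
          ≤ Real.exp (1 * ‖u‖) * B * Real.exp ‖u‖ := by
            gcongr
            · exact Real.exp_le_exp.1 (hexp α u hα)
            · exact hB _
        _ = B * Real.exp (2 * ‖u‖) := by
            rw [show 2 * ‖u‖ = 1 * ‖u‖ + ‖u‖ by ring, Real.exp_add]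
            ring
    · have h1 : HasFDerivAt (fun α : E d => ⟪α, u⟫ - ‖α‖ ^ 2 / 2)
          (innerSL ℝ u - innerSL ℝ α) α := by
        have h2 : HasFDerivAt (fun α : E d => ⟪α, u⟫) (innerSL ℝ u) α := by
          have := (innerSL ℝ u).hasFDerivAt (x := α)
          simpa [real_inner_comm] using this
        have h3 := ((hasStrictFDerivAt_norm_sq α).hasFDerivAt).mul_const (1 / 2 : ℝ)
        refine (h2.sub h3).congr_fderiv ?_ |>.congr_of_eventuallyEq (.of_forall fun β => ?_)
        · ext v
          simp
        · simp [div_eq_mul_inv]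
      refine (h1.exp.mul_const (h (x + t • u))).congr_fderiv ?_
      simp only [F']
      module
  -- Moving the base point from `x` to `y` shifts the Gaussian variable by `α = t⁻¹(y - x)`.
  have hlin : HasFDerivAt (fun y : E d => t⁻¹ • (y - x)) (t⁻¹ • ContinuousLinearMap.id ℝ (E d)) x :=
    ((hasFDerivAt_id x).sub_const x).const_smul t⁻¹
  have hF2 : HasFDerivAt (fun α => ∫ u, F α u ∂(gauss d)) (∫ u, F' 0 u ∂(gauss d))
      (t⁻¹ • (x - x)) := by simpa using hF
  have hcomp := hF2.comp x hlin
  rw [hasGradientAt_iff_hasFDerivAt]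
  refine (hcomp.congr_of_eventuallyEq (.of_forall fun y => ?_)).congr_fderiv ?_
  · have := integral_gauss_add (t⁻¹ • (y - x)) (fun u => h (x + t • u))
    simp only [Function.comp_apply, F, ← this, smoothed]
    congr 1
    funext u
    congr 1
    rw [smul_add, smul_smul, mul_inv_cancel₀ ht.ne']
    module
  · ext v
    have hi := integrable_smul_self hm (fun u => hB (x + t • u))
    have hF'0 : (fun u => F' 0 u) = fun u => innerSL ℝ (h (x + t • u) • u) := by
      funext u
      simp [F']
    rw [hF'0, ContinuousLinearMap.integral_comp_comm _ hi]
    simp only [ContinuousLinearMap.comp_apply, smul_apply,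
      ContinuousLinearMap.id_apply, map_smul, smul_eq_mul, InnerProductSpace.toDual_apply_apply,
      innerSL_apply_apply ℝ]
    exact real_inner_smul_right _ _ _

theorem gradient_smoothed {h : E d → ℝ} {B t : ℝ} (hh : Measurable h)
    (hB : ∀ x, |h x| ≤ B) (ht : 0 < t) (x : E d) :
    gradient (fun y => smoothed h y t) x = t⁻¹ • ∫ u, h (x + t • u) • u ∂(gauss d) :=
  (hasGradientAt_smoothed hh hB ht x).gradient

theorem isLip_of_norm_gradient_le {h : E d → ℝ} {L : ℝ} (hd : Differentiable ℝ h)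
    (hL : ∀ x, ‖gradient h x‖ ≤ L) : IsLip L h := by
  intro x y
  have := Convex.norm_image_sub_le_of_norm_fderiv_le (𝕜 := ℝ) (f := h) (s := Set.univ) (C := L)
    (fun z _ => hd z) (fun z _ => by
      rw [← toDual_gradient, LinearIsometryEquiv.norm_map]
      exact hL z) convex_univ (Set.mem_univ y) (Set.mem_univ x)
  simpa using this

theorem abs_smoothed_le {h : E d → ℝ} {B : ℝ} (hB : ∀ x, |h x| ≤ B) (t : ℝ) (x : E d) :
    |smoothed h x t| ≤ B := by
  have := norm_integral_le_of_norm_le_const (μ := gauss d) (f := fun u => h (x + t • u))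
    (ae_of_all _ fun u => (Real.norm_eq_abs _).trans_le (hB _))
  simpa [smoothed] using this

theorem isLip_smoothed {h : E d → ℝ} {B t : ℝ} (hh : Measurable h)
    (hB : ∀ x, |h x| ≤ B) (ht : 0 < t) : IsLip (B / t) (fun y => smoothed h y t) := by
  refine isLip_of_norm_gradient_le
    (fun x => (hasGradientAt_smoothed hh hB ht x).differentiableAt) fun x => ?_
  rw [gradient_smoothed hh hB ht, norm_smul, Real.norm_of_nonneg (inv_nonneg.2 ht.le),
    inv_mul_eq_div]
  gcongr
  exact norm_integral_smul_self_le (hh.comp (by fun_prop)) fun u => hB _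

theorem smoothed_smoothed {h : E d → ℝ} {B : ℝ} (hh : Measurable h)
    (hB : ∀ x, |h x| ≤ B) (t : ℝ) (x : E d) :
    smoothed h x t = smoothed (fun y => smoothed h y (t * (√2 / 2))) x (t * (√2 / 2)) := by
  have hm : Measurable fun u => h (x + t • u) := hh.comp (by fun_prop)
  have hm2 : Measurable fun p : E d × E d =>
    h (x + (t * (√2 / 2)) • p.1 + (t * (√2 / 2)) • p.2) := hh.comp (by fun_prop)
  simp only [smoothed]
  rw [← integral_prod (fun p : E d × E d =>
    h (x + (t * (√2 / 2)) • p.1 + (t * (√2 / 2)) • p.2))]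
  · change ∫ u, h (x + t • u) ∂(gauss d) = _
    conv_lhs => rw [← gauss_prod_map]
    rw [integral_map (by fun_prop) hm.aestronglyMeasurable]
    simp only [smul_add, smul_smul, add_assoc]
  · exact Integrable.mono' (integrable_const B) hm2.aestronglyMeasurable
      (ae_of_all _ fun p => (Real.norm_eq_abs _).trans_le (hB _))

/-- Gaussian smoothing of a bounded function is smooth, with a dimension-free constant. -/
theorem isSmooth_smoothed {h : E d → ℝ} {B t : ℝ} (hh : Measurable h)
    (hB : ∀ x, |h x| ≤ B) (ht : 0 < t) :
    IsSmooth (2 * B / t ^ 2) (fun y => smoothed h y t) := by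
  refine ⟨fun x => (hasGradientAt_smoothed hh hB ht x).differentiableAt, fun x y => ?_⟩
  -- Two smoothings at `τ = t/√2`: the inner one is `B/τ`-Lipschitz, and the gradient formula for
  -- the outer one gains another `1/τ`, so `B/τ² = 2B/t²`.
  set τ := t * (√2 / 2) with hτ
  have hτ0 : 0 < τ := by positivity
  have hτ2 : τ ^ 2 = t ^ 2 / 2 := by
    rw [hτ, mul_pow, div_pow, Real.sq_sqrt zero_le_two]
    ring
  set g : E d → ℝ := fun y => smoothed h y τ with hg
  have hgl : IsLip (B / τ) g := isLip_smoothed hh hB hτ0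
  have hgm : Measurable g :=
    (show Differentiable ℝ g from fun x =>
      (hasGradientAt_smoothed hh hB hτ0 x).differentiableAt).continuous.measurable
  have hgB : ∀ x, |g x| ≤ B := abs_smoothed_le hB τ
  have he : (fun y => smoothed h y t) = fun y => smoothed g y τ :=
    funext fun y => smoothed_smoothed hh hB t y
  have hmx : ∀ x, Measurable fun u => g (x + τ • u) := fun x => hgm.comp (by fun_prop)
  rw [he, gradient_smoothed hgm hgB hτ0, gradient_smoothed hgm hgB hτ0, ← smul_sub,
    ← integral_sub (integrable_smul_self (hmx x) fun u => hgB _)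
      (integrable_smul_self (hmx y) fun u => hgB _), norm_smul,
    Real.norm_of_nonneg (inv_nonneg.2 hτ0.le)]
  simp only [← sub_smul]
  have := norm_integral_smul_self_le (k := fun u => g (x + τ • u) - g (y + τ • u))
    (B := B / τ * ‖x - y‖) ((hmx x).sub (hmx y)) fun u => by
      simpa using hgl (x + τ • u) (y + τ • u)
  calc τ⁻¹ * ‖∫ u, (g (x + τ • u) - g (y + τ • u)) • u ∂(gauss d)‖
      ≤ τ⁻¹ * (B / τ * ‖x - y‖) := by gcongr
    _ = B / τ ^ 2 * ‖x - y‖ := by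
      field_simp
    _ = 2 * B / t ^ 2 * ‖x - y‖ := by
      rw [hτ2]
      field_simp

/-! ### Smooth and Lipschitz functions, and their means -/

theorem IsSmooth.add {h k : E d → ℝ} {L L' : ℝ} (hh : IsSmooth L h) (hk : IsSmooth L' k) :
    IsSmooth (L + L') (fun x => h x + k x) := by
  refine ⟨hh.1.add hk.1, fun x y => ?_⟩
  have e : ∀ x, gradient (fun x => h x + k x) x = gradient h x + gradient k x := fun x =>
    HasGradientAt.gradient <| by
      have := (hh.1 x).hasGradientAt.hasFDerivAt.add (hk.1 x).hasGradientAt.hasFDerivAt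
      rw [hasGradientAt_iff_hasFDerivAt, map_add]
      exact this
  rw [e, e, add_sub_add_comm, add_mul]
  exact (norm_add_le _ _).trans (add_le_add (hh.2 x y) (hk.2 x y))

theorem gradLip_le {h : E d → ℝ} {L : ℝ} (hL : 0 ≤ L) (hh : IsSmooth L h) : gradLip h ≤ L :=
  csInf_le ⟨0, fun _ h => h.1⟩ ⟨hL, hh⟩

theorem IsLip.norm_gradient_le {h : E d → ℝ} {L : ℝ} (hL : 0 ≤ L) (hh : IsLip L h) (x : E d) :
    ‖gradient h x‖ ≤ L := by
  have h1 : LipschitzWith ⟨L, hL⟩ h := LipschitzWith.of_dist_le_mul fun x y => by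
    rw [Real.dist_eq, dist_eq_norm]
    exact hh x y
  have := norm_fderiv_le_of_lipschitz ℝ h1 (x₀ := x)
  rwa [← toDual_gradient, LinearIsometryEquiv.norm_map] at this

theorem IsLip.continuous {h : E d → ℝ} {L : ℝ} (hL : 0 ≤ L) (hh : IsLip L h) : Continuous h :=
  (LipschitzWith.of_dist_le_mul (K := ⟨L, hL⟩) fun x y => by
    rw [Real.dist_eq, dist_eq_norm]
    exact hh x y).continuous

section Mean

variable {Ξ : Type*} [MeasurableSpace Ξ]

/-- Each coordinate of the gradient is a pointwise limit of difference quotients, which are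
measurable in the sample. -/
theorem measurable_gradient_param {g : E d → Ξ → ℝ} (hm : ∀ x, Measurable (g x))
    (hd : ∀ s, Differentiable ℝ fun x => g x s) (x : E d) :
    Measurable fun s => gradient (fun y => g y s) x := by
  have hc : ∀ i : Fin d, Measurable fun s => gradient (fun y => g y s) x i := by
    intro i
    have hlim : ∀ s, Filter.Tendsto
        (fun n : ℕ => (n : ℝ) * (g (x + (n : ℝ)⁻¹ • EuclideanSpace.single i (1 : ℝ)) s - g x s))
        Filter.atTop (nhds (gradient (fun y => g y s) x i)) := by
      intro s
      have h1 := (hd s x).hasFDerivAt.hasLineDerivAt (EuclideanSpace.single i (1 : ℝ))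
      rw [← inner_gradient_left, EuclideanSpace.inner_single_right] at h1
      have h2 := hasDerivAt_iff_tendsto_slope_zero.1 h1
      have h3 : Filter.Tendsto (fun n : ℕ => ((n : ℝ))⁻¹) Filter.atTop (nhdsWithin 0 {0}ᶜ) := by
        refine tendsto_nhdsWithin_iff.2 ⟨tendsto_inv_atTop_nhds_zero_nat, ?_⟩
        filter_upwards [Filter.eventually_gt_atTop 0] with n hn
        simp only [Set.mem_compl_iff, Set.mem_singleton_iff, inv_eq_zero]
        positivity
      simpa [Function.comp_def] using h2.comp h3
    exact measurable_of_tendsto_metrizable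
      (fun n => ((hm _).sub (hm _)).const_mul _) (tendsto_pi_nhds.2 hlim)
  have := (PiLp.continuous_toLp 2 (fun _ : Fin d => ℝ)).measurable.comp (measurable_pi_lambda _ hc)
  exact this

theorem hasGradientAt_meanFn {P : Measure Ξ} [IsProbabilityMeasure P] {g : E d → Ξ → ℝ}
    {M L : ℝ} (hL : 0 ≤ L) (hm : ∀ x, Measurable (g x)) (hM : ∀ x s, |g x s| ≤ M)
    (hd : ∀ s, Differentiable ℝ fun x => g x s) (hlip : ∀ s, IsLip L fun x => g x s) (x : E d) :
    HasGradientAt (meanFn P g) (∫ s, gradient (fun y => g y s) x ∂P) x := by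
  have hgm := measurable_gradient_param hm hd x
  have hgi : Integrable (fun s => gradient (fun y => g y s) x) P :=
    Integrable.mono' (integrable_const L) hgm.aestronglyMeasurable
      (ae_of_all _ fun s => (hlip s).norm_gradient_le hL x)
  have h := hasFDerivAt_integral_of_dominated_loc_of_lip' (μ := P) (F := g) (x₀ := x)
    (F' := fun s => innerSL ℝ (gradient (fun y => g y s) x)) (bound := fun _ => L)
    (s := Set.univ) Filter.univ_mem (fun y _ => (hm y).aestronglyMeasurable)
    (Integrable.mono' (integrable_const M) (hm x).aestronglyMeasurable
      (ae_of_all _ fun s => (Real.norm_eq_abs _).trans_le (hM x s)))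
    ((innerSL ℝ).continuous.comp_aestronglyMeasurable hgm.aestronglyMeasurable)
    (ae_of_all _ fun s y _ => hlip s y x) (integrable_const L)
    (ae_of_all _ fun s => (hd s x).hasGradientAt.hasFDerivAt)
  rw [hasGradientAt_iff_hasFDerivAt]
  refine h.2.congr_fderiv ?_
  exact ContinuousLinearMap.integral_comp_comm (innerSL ℝ) hgi

theorem isSmooth_meanFn {P : Measure Ξ} [IsProbabilityMeasure P] {g : E d → Ξ → ℝ}
    {M L L' : ℝ} (hL : 0 ≤ L) (hm : ∀ x, Measurable (g x)) (hM : ∀ x s, |g x s| ≤ M)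
    (hs : ∀ s, IsSmooth L' fun x => g x s) (hlip : ∀ s, IsLip L fun x => g x s) :
    IsSmooth L' (meanFn P g) := by
  have hG := hasGradientAt_meanFn (P := P) hL hm hM (fun s => (hs s).1) hlip
  have hgi : ∀ x, Integrable (fun s => gradient (fun y => g y s) x) P := fun x =>
    Integrable.mono' (integrable_const L)
      (measurable_gradient_param hm (fun s => (hs s).1) x).aestronglyMeasurable
      (ae_of_all _ fun s => (hlip s).norm_gradient_le hL x)
  refine ⟨fun x => (hG x).differentiableAt, fun x y => ?_⟩
  rw [(hG x).gradient, (hG y).gradient, ← integral_sub (hgi x) (hgi y)]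
  have := norm_integral_le_of_norm_le_const (μ := P)
    (ae_of_all _ fun s => (hs s).2 x y)
  simpa using this

theorem isLip_meanFn {P : Measure Ξ} [IsProbabilityMeasure P] {g : E d → Ξ → ℝ}
    {M L : ℝ} (hm : ∀ x, Measurable (g x)) (hM : ∀ x s, |g x s| ≤ M)
    (hlip : ∀ s, IsLip L fun x => g x s) : IsLip L (meanFn P g) := by
  have hi : ∀ x, Integrable (g x) P := fun x =>
    Integrable.mono' (integrable_const M) (hm x).aestronglyMeasurable
      (ae_of_all _ fun s => (Real.norm_eq_abs _).trans_le (hM x s))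
  intro x y
  rw [meanFn, meanFn, ← integral_sub (hi x) (hi y)]
  have := norm_integral_le_of_norm_le_const (μ := P)
    (ae_of_all _ fun s => (Real.norm_eq_abs _).trans_le (hlip s x y))
  simpa using this

theorem abs_meanFn_le {P : Measure Ξ} [IsProbabilityMeasure P] {g : E d → Ξ → ℝ}
    {M : ℝ} (hM : ∀ x s, |g x s| ≤ M) (x : E d) : |meanFn P g x| ≤ M := by
  have := norm_integral_le_of_norm_le_const (μ := P)
    (ae_of_all _ fun s => (Real.norm_eq_abs _).trans_le (hM x s))
  simpa [meanFn] using this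

end Mean

/-! ### The two-point estimator compared with the gradient -/

theorem IsSmooth.abs_sub_sub_inner_le {k : E d → ℝ} {L : ℝ} (hL : 0 ≤ L) (hk : IsSmooth L k)
    (x w : E d) : |k (x + w) - k x - ⟪gradient k x, w⟫| ≤ L * ‖w‖ ^ 2 := by
  have h := Convex.norm_image_sub_le_of_norm_hasFDerivWithin_le' (𝕜 := ℝ) (f := k)
    (f' := fun y => fderiv ℝ k y) (s := Metric.closedBall x ‖w‖) (φ := fderiv ℝ k x)
    (C := L * ‖w‖) (x := x) (y := x + w)
    (fun y _ => (hk.1 y).hasFDerivAt.hasFDerivWithinAt) (fun y hy => ?_)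
    (convex_closedBall x ‖w‖) (by simp) (by simp)
  · rw [add_sub_cancel_left, Real.norm_eq_abs, ← inner_gradient_left] at h
    exact h.trans_eq (by ring)
  · rw [← toDual_gradient, ← toDual_gradient, ← map_sub, LinearIsometryEquiv.norm_map]
    refine (hk.2 y x).trans ?_
    gcongr
    simpa [dist_eq_norm] using hy

/-- The finite difference quotient of `k` at `x` along `u`. -/
noncomputable def diffQuot (k : E d → ℝ) (x : E d) (t : ℝ) (u : E d) : ℝ :=
  (k (x + t • u) - k x) / t

/-- Bound on the mean square error of the zeroth-order gradient estimator. -/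
noncomputable def errBound (d : ℕ) (L ν t : ℝ) : ℝ :=
  2 * L ^ 2 * t ^ 2 * (normalMoment 6 * d ^ 3) + 8 * ν * d

/-- Two inexact values contribute `2ν/t`, and `√ν ≤ t` turns this into `2√ν`, uniformly in `t`. -/
theorem abs_diffQuot_sub_inner_le {k k' : E d → ℝ} {L ν t : ℝ} (hL : 0 ≤ L)
    (hk : IsSmooth L k) (hkk' : ∀ x, |k x - k' x| ≤ ν) (ht : 0 < t) (hν : √ν ≤ t)
    (x u : E d) : |diffQuot k' x t u - ⟪gradient k x, u⟫| ≤ L * t * ‖u‖ ^ 2 + 2 * √ν := by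
  have hν0 : 0 ≤ ν := (abs_nonneg _).trans (hkk' x)
  have h1 := hk.abs_sub_sub_inner_le hL x (t • u)
  have h2 := hkk' x
  have h3 := hkk' (x + t • u)
  rw [real_inner_smul_right, norm_smul, Real.norm_of_nonneg ht.le] at h1
  have h4 : ν ≤ √ν * t := by
    calc ν = √ν * √ν := (Real.mul_self_sqrt hν0).symm
      _ ≤ √ν * t := by gcongr
  have e : diffQuot k' x t u - ⟪gradient k x, u⟫
      = (k' (x + t • u) - k' x - t * ⟪gradient k x, u⟫) / t := by
    rw [diffQuot]
    field_simp
  rw [e, abs_div, abs_of_pos ht, div_le_iff₀ ht]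
  rw [abs_le] at *
  constructor <;> nlinarith

theorem sq_diffQuot_sub_inner_mul_le {k k' : E d → ℝ} {L ν t : ℝ} (hL : 0 ≤ L)
    (hk : IsSmooth L k) (hkk' : ∀ x, |k x - k' x| ≤ ν) (ht : 0 < t) (hν : √ν ≤ t)
    (x u : E d) : (diffQuot k' x t u - ⟪gradient k x, u⟫) ^ 2 * ‖u‖ ^ 2
      ≤ 2 * L ^ 2 * t ^ 2 * ‖u‖ ^ 6 + 8 * ν * ‖u‖ ^ 2 := by
  have hν0 : 0 ≤ ν := (abs_nonneg _).trans (hkk' x)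
  have h := abs_diffQuot_sub_inner_le hL hk hkk' ht hν x u
  have h1 : (diffQuot k' x t u - ⟪gradient k x, u⟫) ^ 2 ≤ (L * t * ‖u‖ ^ 2 + 2 * √ν) ^ 2 := by
    rw [← sq_abs]
    gcongr
  have h2 : (L * t * ‖u‖ ^ 2 + 2 * √ν) ^ 2 ≤ 2 * L ^ 2 * t ^ 2 * ‖u‖ ^ 4 + 8 * ν := by
    have := Real.sq_sqrt hν0
    nlinarith [sq_nonneg (L * t * ‖u‖ ^ 2 - 2 * √ν)]
  calc _ ≤ (2 * L ^ 2 * t ^ 2 * ‖u‖ ^ 4 + 8 * ν) * ‖u‖ ^ 2 := by gcongr; exact h1.trans h2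
    _ = _ := by ring

theorem integrable_err (L ν t : ℝ) : Integrable
    (fun u : E d => 2 * L ^ 2 * t ^ 2 * ‖u‖ ^ 6 + 8 * ν * ‖u‖ ^ 2) (gauss d) :=
  ((integrable_norm_pow 6).const_mul _).add ((integrable_norm_pow 2).const_mul _)

theorem integral_err_le (hd : 0 < d) (L ν t : ℝ) :
    ∫ u : E d, (2 * L ^ 2 * t ^ 2 * ‖u‖ ^ 6 + 8 * ν * ‖u‖ ^ 2) ∂(gauss d) ≤ errBound d L ν t := by
  rw [integral_add ((integrable_norm_pow 6).const_mul _) ((integrable_norm_pow 2).const_mul _),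
    integral_const_mul, integral_const_mul, integral_norm_sq, errBound]
  gcongr
  exact integral_norm_pow_six_le hd

theorem measurable_diffQuot {k : E d → ℝ} (hk : Measurable k) (x : E d) (t : ℝ) :
    Measurable (diffQuot k x t) := by
  unfold diffQuot
  fun_prop

theorem abs_diffQuot_le {k : E d → ℝ} {B t : ℝ} (hB : ∀ x, |k x| ≤ B) (ht : 0 < t) (x u : E d) :
    |diffQuot k x t u| ≤ 2 * B / t := by
  rw [diffQuot, abs_div, abs_of_pos ht]
  gcongr
  have := abs_sub (k (x + t • u)) (k x)
  linarith [hB x, hB (x + t • u)]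

theorem integrable_diffQuot_sq_mul {k : E d → ℝ} {B t : ℝ} (hk : Measurable k)
    (hB : ∀ x, |k x| ≤ B) (ht : 0 < t) (x : E d) :
    Integrable (fun u => diffQuot k x t u ^ 2 * ‖u‖ ^ 2) (gauss d) := by
  have := measurable_diffQuot hk x t
  refine ((integrable_norm_pow 2).const_mul ((2 * B / t) ^ 2)).mono' (by fun_prop)
    (ae_of_all _ fun u => ?_)
  rw [Real.norm_of_nonneg (by positivity), ← sq_abs (diffQuot k x t u)]
  gcongr
  exact abs_diffQuot_le hB ht x u

theorem integral_diffQuot_sq_mul_le {k k' : E d → ℝ} {L ν t B : ℝ} (hd : 0 < d) (hL : 0 ≤ L)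
    (hk : IsSmooth L k) (hkk' : ∀ x, |k x - k' x| ≤ ν) (hk' : Measurable k')
    (hB : ∀ x, |k' x| ≤ B) (ht : 0 < t) (hν : √ν ≤ t) (x : E d) :
    ∫ u, diffQuot k' x t u ^ 2 * ‖u‖ ^ 2 ∂(gauss d)
      ≤ 2 * (normalMoment 4 * d * ‖gradient k x‖ ^ 2) + 2 * errBound d L ν t := by
  calc ∫ u, diffQuot k' x t u ^ 2 * ‖u‖ ^ 2 ∂(gauss d)
      ≤ ∫ u, (2 * (⟪gradient k x, u⟫ ^ 2 * ‖u‖ ^ 2)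
          + 2 * (2 * L ^ 2 * t ^ 2 * ‖u‖ ^ 6 + 8 * ν * ‖u‖ ^ 2)) ∂(gauss d) := by
        refine integral_mono (integrable_diffQuot_sq_mul hk' hB ht x)
          (((integrable_inner_sq_mul_norm_sq _).const_mul 2).add
            ((integrable_err L ν t).const_mul 2)) fun u => ?_
        have h := sq_diffQuot_sub_inner_mul_le hL hk hkk' ht hν x u
        have h2 : diffQuot k' x t u ^ 2 ≤ 2 * ⟪gradient k x, u⟫ ^ 2
            + 2 * (diffQuot k' x t u - ⟪gradient k x, u⟫) ^ 2 := by
          nlinarith [sq_nonneg (diffQuot k' x t u - 2 * ⟪gradient k x, u⟫)]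
        have h3 := mul_le_mul_of_nonneg_right h2 (sq_nonneg ‖u‖)
        simp only
        linarith
    _ ≤ _ := by
        rw [integral_add ((integrable_inner_sq_mul_norm_sq _).const_mul 2)
          ((integrable_err L ν t).const_mul 2), integral_const_mul, integral_const_mul]
        gcongr
        · exact integral_inner_sq_mul_norm_sq_le _
        · exact integral_err_le hd L ν t

theorem integrable_diffQuot_mul_inner {k : E d → ℝ} {B t : ℝ} (hk : Measurable k)
    (hB : ∀ x, |k x| ≤ B) (ht : 0 < t) (x a : E d) :
    Integrable (fun u => diffQuot k x t u * ⟪a, u⟫) (gauss d) := by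
  simpa only [real_inner_smul_right] using (integrable_smul_self (measurable_diffQuot hk x t)
    (abs_diffQuot_le hB ht x)).const_inner (𝕜 := ℝ) a

/-- With `e` the error of the quotient, `e⟪G, u⟫ ≥ -(e²‖u‖² + ‖G‖²)/2`, while `𝔼⟪G, u⟫² = ‖G‖²`.
Half of the squared gradient survives. -/
theorem le_integral_diffQuot_mul_inner {k k' : E d → ℝ} {L ν t B : ℝ} (hd : 0 < d) (hL : 0 ≤ L)
    (hk : IsSmooth L k) (hkk' : ∀ x, |k x - k' x| ≤ ν) (hk' : Measurable k')
    (hB : ∀ x, |k' x| ≤ B) (ht : 0 < t) (hν : √ν ≤ t) (x : E d) :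
    ‖gradient k x‖ ^ 2 / 2 - errBound d L ν t / 2
      ≤ ∫ u, diffQuot k' x t u * ⟪gradient k x, u⟫ ∂(gauss d) := by
  set G := gradient k x
  have hi1 : Integrable (fun u : E d => ⟪G, u⟫ ^ 2 - ‖G‖ ^ 2 / 2) (gauss d) :=
    (integrable_inner_pow G 2).sub (integrable_const _)
  have hi2 : Integrable (fun u : E d =>
      (2 * L ^ 2 * t ^ 2 * ‖u‖ ^ 6 + 8 * ν * ‖u‖ ^ 2) / 2) (gauss d) :=
    (integrable_err L ν t).div_const 2
  calc ‖G‖ ^ 2 / 2 - errBound d L ν t / 2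
      ≤ ∫ u, (⟪G, u⟫ ^ 2 - ‖G‖ ^ 2 / 2)
          - (2 * L ^ 2 * t ^ 2 * ‖u‖ ^ 6 + 8 * ν * ‖u‖ ^ 2) / 2 ∂(gauss d) := by
        rw [integral_sub hi1 hi2, integral_sub (integrable_inner_pow G 2) (integrable_const _),
          integral_inner_sq, integral_const, probReal_univ, one_smul, integral_div]
        linarith [integral_err_le hd L ν t]
    _ ≤ _ := by
        refine integral_mono (hi1.sub hi2) (integrable_diffQuot_mul_inner hk' hB ht x G)
          fun u => ?_
        have h := sq_diffQuot_sub_inner_mul_le hL hk hkk' ht hν x u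
        have h1 : ⟪G, u⟫ ^ 2 ≤ (‖G‖ * ‖u‖) ^ 2 :=
          sq_le_sq' (neg_le_of_abs_le (abs_real_inner_le_norm G u)) (real_inner_le_norm G u)
        have h2 : |(diffQuot k' x t u - ⟪G, u⟫) * ⟪G, u⟫|
            ≤ (|diffQuot k' x t u - ⟪G, u⟫| * ‖u‖) * ‖G‖ := by
          rw [abs_mul, mul_assoc, mul_comm ‖u‖]
          gcongr
          exact abs_real_inner_le_norm G u
        have h3 := two_mul_le_add_sq (|diffQuot k' x t u - ⟪G, u⟫| * ‖u‖) ‖G‖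
        rw [mul_pow, sq_abs] at h3
        have h4 := neg_abs_le ((diffQuot k' x t u - ⟪G, u⟫) * ⟪G, u⟫)
        simp only
        nlinarith

/-! ### Expected descent in one iteration -/

section Step

variable {Ξ : Type*}

theorem gradEst_eq (g : E d → Ξ → ℝ) (x : E d) (t : ℝ) (s : Ξ) (u : E d) :
    gradEst g x t s u = diffQuot (fun y => g y s) x t u • u := rfl

variable [MeasurableSpace Ξ]

theorem measurable_meanFn {P : Measure Ξ} [SFinite P] {g : E d → Ξ → ℝ}
    (hg : Measurable (Function.uncurry g)) : Measurable (meanFn P g) :=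
  (hg.stronglyMeasurable.integral_prod_right (ν := P)).measurable

/-- Expected decrease of the objective in one iteration. -/
theorem integral_step_le {P : Measure Ξ} [IsProbabilityMeasure P] {g g' : E d → Ξ → ℝ}
    {M L₀ L₁ ν B t β : ℝ} (hd : 0 < d) (hL₀ : 0 ≤ L₀) (hL₁ : 0 ≤ L₁) (hβ : 0 ≤ β)
    (hm : ∀ x, Measurable (g x)) (hM : ∀ x s, |g x s| ≤ M)
    (hlip : ∀ s, IsLip L₀ fun x => g x s) (hs : ∀ s, IsSmooth L₁ fun x => g x s)
    (hg' : Measurable (Function.uncurry g')) (hB : ∀ x s, |g' x s| ≤ B)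
    (hgg' : ∀ x s, |g x s - g' x s| ≤ ν) (ht : 0 < t) (hν : √ν ≤ t) (x : E d) :
    ∫ z, meanFn P g (x - β • gradEst g' x t z.1 z.2) ∂(P.prod (gauss d))
      ≤ meanFn P g x - β / 2 * ‖gradient (meanFn P g) x‖ ^ 2 + β / 2 * errBound d L₁ ν t
        + L₁ * β ^ 2 * (2 * (normalMoment 4 * d * L₀ ^ 2) + 2 * errBound d L₁ ν t) := by
  set f := meanFn P g with hf
  have hfs : IsSmooth L₁ f := isSmooth_meanFn hL₀ hm hM hs hlip
  have hfc : Continuous f := hfs.1.continuous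
  have hfM : ∀ x, |f x| ≤ M := abs_meanFn_le hM
  set G := gradient f x with hG
  let q : Ξ × E d → ℝ := fun z => diffQuot (fun y => g' y z.1) x t z.2
  have hqm : Measurable q := by
    have h1 : Measurable fun z : Ξ × E d => g' (x + t • z.2) z.1 :=
      hg'.comp (g := Function.uncurry g')
        (f := fun z : Ξ × E d => (x + t • z.2, z.1)) (by fun_prop)
    have h2 : Measurable fun z : Ξ × E d => g' x z.1 :=
      hg'.comp (g := Function.uncurry g') (f := fun z : Ξ × E d => (x, z.1)) (by fun_prop)
    exact (h1.sub h2).div_const t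
  have hqB : ∀ z, |q z| ≤ 2 * B / t := fun z => abs_diffQuot_le (fun y => hB y z.1) ht x z.2
  have hg's : ∀ s, Measurable fun y => g' y s := fun s =>
    hg'.comp (g := Function.uncurry g') (f := fun y => (y, s)) (by fun_prop)
  have hint : ∀ n, Integrable (fun z : Ξ × E d => ‖z.2‖ ^ n) (P.prod (gauss d)) := fun n =>
    (integrable_norm_pow n).comp_snd P
  have hi1 : Integrable (fun z => q z * ⟪G, z.2⟫) (P.prod (gauss d)) := by
    refine ((hint 1).const_mul (2 * B / t * ‖G‖)).mono' (by fun_prop) (ae_of_all _ fun z => ?_)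
    rw [norm_mul, pow_one, mul_assoc]
    exact mul_le_mul (hqB z) (norm_inner_le_norm G z.2) (norm_nonneg _)
      ((abs_nonneg _).trans (hqB z))
  have hi2 : Integrable (fun z => q z ^ 2 * ‖z.2‖ ^ 2) (P.prod (gauss d)) := by
    refine ((hint 2).const_mul ((2 * B / t) ^ 2)).mono' (by fun_prop) (ae_of_all _ fun z => ?_)
    rw [Real.norm_of_nonneg (by positivity), ← sq_abs (q z)]
    gcongr
    exact hqB z
  have h1 : ‖G‖ ^ 2 / 2 - errBound d L₁ ν t / 2
      ≤ ∫ z, q z * ⟪G, z.2⟫ ∂(P.prod (gauss d)) := by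
    -- The linear term is averaged over the sample first, which leaves the quotient of the mean of
    -- `g'` against the gradient of `f`.
    rw [integral_prod_symm _ hi1]
    have hi : ∀ y, Integrable (g' y) P := fun y => Integrable.mono' (integrable_const B)
      (hg'.comp (g := Function.uncurry g') (f := fun s => (y, s)) (by fun_prop)).aestronglyMeasurable
      (ae_of_all _ fun s => (Real.norm_eq_abs _).trans_le (hB y s))
    have hig : ∀ y, Integrable (g y) P := fun y => Integrable.mono' (integrable_const M)
      (hm y).aestronglyMeasurable (ae_of_all _ fun s => (Real.norm_eq_abs _).trans_le (hM y s))
    have e : ∀ u, ∫ s, q (s, u) * ⟪G, u⟫ ∂P = diffQuot (meanFn P g') x t u * ⟪G, u⟫ := by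
      intro u
      rw [integral_mul_const]
      congr 1
      simp only [q, diffQuot, meanFn]
      rw [integral_div, integral_sub (hi _) (hi _)]
    simp only [e]
    refine le_integral_diffQuot_mul_inner hd hL₁ hfs (fun y => ?_) (measurable_meanFn hg')
      (abs_meanFn_le hB) ht hν x
    rw [hf, meanFn, meanFn, ← integral_sub (hig y) (hi y)]
    have := norm_integral_le_of_norm_le_const (μ := P)
      (ae_of_all _ fun s => (Real.norm_eq_abs _).trans_le (hgg' y s))
    simpa using this
  have h2 : ∫ z, q z ^ 2 * ‖z.2‖ ^ 2 ∂(P.prod (gauss d))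
      ≤ 2 * (normalMoment 4 * d * L₀ ^ 2) + 2 * errBound d L₁ ν t := by
    -- The quadratic term is averaged over `u` first, sample by sample, each gradient being at most
    -- `L₀`.
    rw [integral_prod _ hi2]
    have hb : ∀ s, ∫ u, q (s, u) ^ 2 * ‖u‖ ^ 2 ∂(gauss d)
        ≤ 2 * (normalMoment 4 * d * L₀ ^ 2) + 2 * errBound d L₁ ν t := by
      intro s
      refine (integral_diffQuot_sq_mul_le hd hL₁ (hs s) (fun y => hgg' y s) (hg's s)
        (fun y => hB y s) ht hν x).trans ?_
      have := (hlip s).norm_gradient_le hL₀ x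
      have := normalMoment_nonneg 4 (by decide)
      gcongr
    calc _ ≤ ∫ _, (2 * (normalMoment 4 * d * L₀ ^ 2) + 2 * errBound d L₁ ν t) ∂P :=
          integral_mono hi2.integral_prod_left (integrable_const _) hb
      _ = _ := by simp
  have hem : Measurable fun z : Ξ × E d => f (x - β • gradEst g' x t z.1 z.2) := by
    have : Measurable fun z : Ξ × E d => q z • z.2 := by fun_prop
    exact hfc.measurable.comp (measurable_const.sub (this.const_smul β))
  calc ∫ z, f (x - β • gradEst g' x t z.1 z.2) ∂(P.prod (gauss d))
      ≤ ∫ z, ((f x - β * (q z * ⟪G, z.2⟫)) + L₁ * β ^ 2 * (q z ^ 2 * ‖z.2‖ ^ 2))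
          ∂(P.prod (gauss d)) := by
        refine integral_mono (Integrable.mono' (integrable_const M) hem.aestronglyMeasurable
          (ae_of_all _ fun z => (Real.norm_eq_abs _).trans_le (hfM _)))
          (((integrable_const _).sub (hi1.const_mul β)).add (hi2.const_mul _)) fun z => ?_
        have h := (abs_le.1 (hfs.abs_sub_sub_inner_le hL₁ x (-(β • gradEst g' x t z.1 z.2)))).2
        rw [← sub_eq_add_neg, norm_neg, inner_neg_right, gradEst_eq, real_inner_smul_right,
          real_inner_smul_right, norm_smul, norm_smul, mul_pow, mul_pow, Real.norm_eq_abs,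
          Real.norm_eq_abs, sq_abs, sq_abs] at h
        simp only [gradEst_eq, q]
        linarith
    _ = f x - β * ∫ z, q z * ⟪G, z.2⟫ ∂(P.prod (gauss d))
          + L₁ * β ^ 2 * ∫ z, q z ^ 2 * ‖z.2‖ ^ 2 ∂(P.prod (gauss d)) := by
        have hi0 : Integrable (fun z => f x - β * (q z * ⟪G, z.2⟫)) (P.prod (gauss d)) :=
          (integrable_const _).sub (hi1.const_mul β)
        rw [integral_add hi0 (hi2.const_mul _),
          integral_sub (integrable_const _) (hi1.const_mul β), integral_const_mul,
          integral_const_mul, integral_const, probReal_univ, one_smul]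
    _ ≤ _ := by
        have h3 := mul_le_mul_of_nonneg_left h1 hβ
        have h4 := mul_le_mul_of_nonneg_left h2 (by positivity : 0 ≤ L₁ * β ^ 2)
        linarith

end Step

/-! ### Independence and the uniform index -/

theorem integral_comp_indep {Ω A B : Type*} [MeasurableSpace Ω] [MeasurableSpace A]
    [MeasurableSpace B] {μ : Measure Ω} [IsProbabilityMeasure μ] {X : Ω → A} {Y : Ω → B}
    (hX : Measurable X) (hY : Measurable Y) (hXY : IndepFun X Y μ) {φ : A × B → ℝ} {C : ℝ}
    (hφ : Measurable φ) (hC : ∀ p, |φ p| ≤ C) :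
    ∫ ω, φ (X ω, Y ω) ∂μ = ∫ ω, ∫ b, φ (X ω, b) ∂(μ.map Y) ∂μ := by
  have := Measure.isProbabilityMeasure_map (μ := μ) hX.aemeasurable
  have := Measure.isProbabilityMeasure_map (μ := μ) hY.aemeasurable
  have h := (indepFun_iff_map_prod_eq_prod_map_map hX.aemeasurable hY.aemeasurable).1 hXY
  rw [← integral_map (φ := fun ω => (X ω, Y ω)) (f := φ) (hX.prodMk hY).aemeasurable
    hφ.aestronglyMeasurable, h, integral_prod, integral_map hX.aemeasurable]
  · exact hφ.stronglyMeasurable.integral_prod_right'.aestronglyMeasurable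
  · exact Integrable.mono' (integrable_const C) hφ.aestronglyMeasurable
      (ae_of_all _ fun p => (Real.norm_eq_abs _).trans_le (hC p))

theorem integral_uniformOn_Icc (a b : ℕ) (φ : ℕ → ℝ) :
    ∫ k, φ k ∂(uniformOn (Set.Icc a b)) = ((b + 1 - a : ℕ) : ℝ)⁻¹ * ∑ k ∈ Finset.Icc a b, φ k := by
  have hfin : IsFiniteMeasure ((Measure.count : Measure ℕ).restrict (Finset.Icc a b : Finset ℕ)) :=
    ⟨by simp⟩
  have hint : IntegrableOn φ (Finset.Icc a b : Finset ℕ) Measure.count := by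
    have h : IntegrableOn φ (Finset.Icc a b : Finset ℕ)
      ((Measure.count : Measure ℕ).restrict (Finset.Icc a b : Finset ℕ)) := IntegrableOn.finset
    rwa [IntegrableOn, Measure.restrict_restrict (Finset.measurableSet _), Set.inter_self] at h
  rw [uniformOn, ProbabilityTheory.cond, integral_smul_measure, ← Finset.coe_Icc,
    Measure.count_apply_finset, setIntegral_finset _ hint, Nat.card_Icc, ENNReal.toReal_inv,
    ENNReal.toReal_natCast]
  simp

/-! ### The iterates as a random process -/

section Iterates

variable {d : ℕ} {Ξ : Type*}

/-- The state after `n` iterations reads no sample beyond the `n`-th, which is what makes the next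
sample fresh. -/
theorem state_congr (rule : Rule) (g : E d → Ξ → ℝ) (β : ℝ → ℝ) (γ η ν : ℝ) (x₁ : E d) (t₁ : ℝ)
    {z z' : ℕ → Ξ × E d × E d} {n : ℕ} (h : ∀ k ≤ n, z k = z' k) :
    state rule g β γ η ν x₁ t₁ z n = state rule g β γ η ν x₁ t₁ z' n := by
  induction n with
  | zero => rfl
  | succ n ih =>
    simp only [state, ih fun k hk => h k (by omega), h (n + 1) le_rfl]

theorem nextT_le (rule : Rule) (γ η ν t G : ℝ) : nextT rule γ η ν t G ≤ max (γ * t) √ν := by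
  cases rule
  · exact le_rfl
  · exact max_le_max_right _ (min_le_right _ _)

theorem sqrt_le_nextT (rule : Rule) (γ η ν t G : ℝ) : √ν ≤ nextT rule γ η ν t G := by
  cases rule <;> exact le_max_right _ _

theorem nextT_pos {rule : Rule} {γ η ν t G : ℝ} (hγ : 0 < γ) (ht : 0 < t)
    (hν : rule = Rule.derivative → 0 < ν) : 0 < nextT rule γ η ν t G := by
  cases rule
  · exact lt_max_of_lt_left (by positivity)
  · exact lt_max_of_lt_right (Real.sqrt_pos.2 (hν rfl))

/-- Each update lies between the floor and the ratio rule, whatever the derivative estimate; and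
`γ√ν ≤ √ν` keeps the floor from accumulating. -/
theorem state_snd_bounds {rule : Rule} (g : E d → Ξ → ℝ) (β : ℝ → ℝ) {γ η ν t₁ : ℝ} (x₁ : E d)
    (z : ℕ → Ξ × E d × E d) (hγ : 0 < γ) (hγ1 : γ ≤ 1) (ht₁ : 0 < t₁)
    (hν : rule = Rule.derivative → 0 < ν) (hν₁ : √ν ≤ t₁) (n : ℕ) :
    0 < (state rule g β γ η ν x₁ t₁ z n).2 ∧ √ν ≤ (state rule g β γ η ν x₁ t₁ z n).2 ∧
      (state rule g β γ η ν x₁ t₁ z n).2 ≤ max (γ ^ n * t₁) √ν := by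
  induction n with
  | zero => simpa [state] using ⟨ht₁, hν₁⟩
  | succ n ih =>
    obtain ⟨h1, h2, h3⟩ := ih
    refine ⟨nextT_pos hγ h1 hν, sqrt_le_nextT .., (nextT_le ..).trans ?_⟩
    refine max_le ?_ (le_max_right _ _)
    calc γ * _ ≤ γ * max (γ ^ n * t₁) √ν := by gcongr
      _ = max (γ ^ (n + 1) * t₁) (γ * √ν) := by
        rw [mul_max_of_nonneg _ _ hγ.le]
        ring_nf
      _ ≤ max (γ ^ (n + 1) * t₁) √ν :=
        max_le_max_left _ (mul_le_of_le_one_left (Real.sqrt_nonneg ν) hγ1)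

variable [MeasurableSpace Ξ]

theorem measurable_nextT (rule : Rule) (γ η ν : ℝ) :
    Measurable fun p : ℝ × ℝ => nextT rule γ η ν p.1 p.2 := by
  cases rule <;> simp only [nextT] <;> fun_prop

theorem measurable_state (rule : Rule) {g : E d → Ξ → ℝ} (hg : Measurable (Function.uncurry g))
    {β : ℝ → ℝ} (hβ : Measurable β) (γ η ν : ℝ) (x₁ : E d) (t₁ : ℝ) (n : ℕ) :
    Measurable fun z : ℕ → Ξ × E d × E d => state rule g β γ η ν x₁ t₁ z n := by
  induction n with
  | zero => exact measurable_const
  | succ n ih =>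
    have hz := measurable_pi_apply (X := fun _ : ℕ => Ξ × E d × E d) (n + 1)
    have hx := ih.fst
    have ht := ih.snd
    have hs := hz.fst
    have hu := hz.snd.fst
    have hv := hz.snd.snd
    have hgu := hg.comp ((hx.add (ht.smul hu)).prodMk hs)
    have hgv := hg.comp ((hx.add (ht.smul hv)).prodMk hs)
    have hgx := hg.comp (hx.prodMk hs)
    refine Measurable.prodMk ?_ ?_
    · exact hx.sub ((hβ.comp ht).smul ((((hgu.sub hgx).div ht)).smul hu))
    · exact (measurable_nextT rule γ η ν).comp (ht.prodMk
        ((((hv.norm.pow_const 2).sub_const _).mul (hgv.sub hgx)).div (ht.pow_const 2)))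

variable {Ω : Type*} [MeasurableSpace Ω] {μ : Measure Ω}

theorem indepFun_state (rule : Rule) {g : E d → Ξ → ℝ} (hg : Measurable (Function.uncurry g))
    {β : ℝ → ℝ} (hβ : Measurable β) (γ η ν : ℝ) (x₁ : E d) (t₁ : ℝ)
    {ζ : ℕ → Ω → Ξ × E d × E d} (hζ : ∀ k, Measurable (ζ k)) (hind : iIndepFun ζ μ) (n : ℕ) :
    IndepFun (fun ω => state rule g β γ η ν x₁ t₁ (fun k => ζ k ω) n) (ζ (n + 1)) μ := by
  have h := hind.indepFun_finset (Finset.range (n + 1)) {n + 1} (by simp) hζ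
  -- Pads a finite prefix to a full sequence. The filler, the sample of index `0`, is never read by
  -- the state after `n` iterations.
  let ext : ((i : Finset.range (n + 1)) → Ξ × E d × E d) → ℕ → Ξ × E d × E d := fun y k =>
    if hk : k ∈ Finset.range (n + 1) then y ⟨k, hk⟩ else y ⟨0, by simp⟩
  have hext : Measurable ext := by
    refine measurable_pi_lambda _ fun k => ?_
    by_cases hk : k ∈ Finset.range (n + 1)
    · simp only [ext, hk, dif_pos]
      exact measurable_pi_apply _
    · simp only [ext, hk, dif_neg, not_false_eq_true]
      exact measurable_pi_apply _
  have h2 := h.comp ((measurable_state rule hg hβ γ η ν x₁ t₁ n).comp hext)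
    (measurable_pi_apply (X := fun _ : ({n + 1} : Finset ℕ) => Ξ × E d × E d) ⟨n + 1, by simp⟩)
  refine IndepFun.congr h2 (.of_forall fun ω => ?_) (.of_forall fun _ => rfl)
  symm
  refine state_congr rule g β γ η ν x₁ t₁ fun k hk => ?_
  have : k ∈ Finset.range (n + 1) := by simp; omega
  simp only [ext, this, dif_pos]

variable [IsProbabilityMeasure μ]

/-- Given the current state, the next sample still has its original law, so the one-step bound may
be integrated over states. `R` is deterministic. -/
theorem integral_state_succ_le {P : Measure Ξ} [IsProbabilityMeasure P] (rule : Rule)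
    {g : E d → Ξ → ℝ} (hg : Measurable (Function.uncurry g))
    {β : ℝ → ℝ} (hβ : Measurable β) {γ η ν : ℝ} {x₁ : E d} {t₁ : ℝ}
    {ζ : ℕ → Ω → Ξ × E d × E d} (hζ : ∀ k, Measurable (ζ k)) (hind : iIndepFun ζ μ)
    (hlaw : ∀ k, μ.map (ζ k) = P.prod ((gauss d).prod (gauss d)))
    {f φ : E d → ℝ} {M L : ℝ} (hf : Measurable f) (hφ : Measurable φ)
    (hM : ∀ x, |f x| ≤ M) (hL : ∀ x, |φ x| ≤ L) {R : ℝ} {n : ℕ}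
    (hstep : ∀ ω, ∫ z, f ((state rule g β γ η ν x₁ t₁ (fun k => ζ k ω) n).1
        - β (state rule g β γ η ν x₁ t₁ (fun k => ζ k ω) n).2 •
          gradEst g (state rule g β γ η ν x₁ t₁ (fun k => ζ k ω) n).1
            (state rule g β γ η ν x₁ t₁ (fun k => ζ k ω) n).2 z.1 z.2) ∂(P.prod (gauss d))
      ≤ f (state rule g β γ η ν x₁ t₁ (fun k => ζ k ω) n).1
        - φ (state rule g β γ η ν x₁ t₁ (fun k => ζ k ω) n).1 + R) :
    ∫ ω, f (state rule g β γ η ν x₁ t₁ (fun k => ζ k ω) (n + 1)).1 ∂μ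
      ≤ ∫ ω, f (state rule g β γ η ν x₁ t₁ (fun k => ζ k ω) n).1 ∂μ
        - ∫ ω, φ (state rule g β γ η ν x₁ t₁ (fun k => ζ k ω) n).1 ∂μ + R := by
  set S : Ω → E d × ℝ := fun ω => state rule g β γ η ν x₁ t₁ (fun k => ζ k ω) n with hS
  have hSm : Measurable S :=
    (measurable_state rule hg hβ γ η ν x₁ t₁ n).comp (measurable_pi_lambda _ hζ)
  let ψ : (E d × ℝ) × (Ξ × E d × E d) → ℝ := fun p =>
    f (p.1.1 - β p.1.2 • gradEst g p.1.1 p.1.2 p.2.1 p.2.2.1)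
  have hψ : Measurable ψ := by
    have hx : Measurable fun p : (E d × ℝ) × (Ξ × E d × E d) => p.1.1 := by fun_prop
    have ht : Measurable fun p : (E d × ℝ) × (Ξ × E d × E d) => p.1.2 := by fun_prop
    have hs : Measurable fun p : (E d × ℝ) × (Ξ × E d × E d) => p.2.1 := by fun_prop
    have hu : Measurable fun p : (E d × ℝ) × (Ξ × E d × E d) => p.2.2.1 := by fun_prop
    have hgu := hg.comp ((hx.add (ht.smul hu)).prodMk hs)
    have hgx := hg.comp (hx.prodMk hs)
    exact hf.comp (hx.sub ((hβ.comp ht).smul ((((hgu.sub hgx).div ht)).smul hu)))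
  -- The update of `x` ignores `v`, so `v` is integrated out.
  have hproj : (P.prod ((gauss d).prod (gauss d))).map (fun z => (z.1, z.2.1))
      = P.prod (gauss d) := by
    have h1 := Measure.map_prod_map P ((gauss d).prod (gauss d)) (f := id) (g := Prod.fst)
      measurable_id measurable_fst
    rw [Measure.map_id, Measure.map_fst_prod, measure_univ, one_smul] at h1
    exact h1.symm
  have hin : ∀ ω, ∫ z, ψ (S ω, z) ∂(μ.map (ζ (n + 1)))
      = ∫ z, f ((S ω).1 - β (S ω).2 • gradEst g (S ω).1 (S ω).2 z.1 z.2) ∂(P.prod (gauss d)) := by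
    intro ω
    rw [hlaw, ← hproj, integral_map (by fun_prop)]
    have hu : Measurable fun z : Ξ × E d => g ((S ω).1 + (S ω).2 • z.2) z.1 :=
      hg.comp (g := Function.uncurry g)
        (f := fun z : Ξ × E d => ((S ω).1 + (S ω).2 • z.2, z.1)) (by fun_prop)
    have hx : Measurable fun z : Ξ × E d => g (S ω).1 z.1 :=
      hg.comp (g := Function.uncurry g) (f := fun z : Ξ × E d => ((S ω).1, z.1)) (by fun_prop)
    have : Measurable fun z : Ξ × E d =>
        f ((S ω).1 - β (S ω).2 • gradEst g (S ω).1 (S ω).2 z.1 z.2) :=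
      hf.comp (measurable_const.sub
        ((((hu.sub hx).div_const (S ω).2).smul measurable_snd).const_smul (β (S ω).2)))
    exact this.aestronglyMeasurable
  have hbd : ∀ {ρ : E d → ℝ} {C : ℝ}, Measurable ρ → (∀ x, |ρ x| ≤ C) →
      Integrable (fun ω => ρ (S ω).1) μ := fun hρ hC =>
    Integrable.mono' (integrable_const _) (hρ.comp hSm.fst).aestronglyMeasurable
      (ae_of_all _ fun ω => (Real.norm_eq_abs _).trans_le (hC _))
  calc ∫ ω, f (state rule g β γ η ν x₁ t₁ (fun k => ζ k ω) (n + 1)).1 ∂μ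
      = ∫ ω, ψ (S ω, ζ (n + 1) ω) ∂μ := rfl
    _ = ∫ ω, ∫ z, ψ (S ω, z) ∂(μ.map (ζ (n + 1))) ∂μ :=
        integral_comp_indep hSm (hζ _) (indepFun_state rule hg hβ γ η ν x₁ t₁ hζ hind n)
          hψ fun p => hM _
    _ ≤ ∫ ω, (f (S ω).1 - φ (S ω).1 + R) ∂μ := by
        refine integral_mono ?_ (((hbd hf hM).sub (hbd hφ hL)).add (integrable_const R))
          fun ω => (hin ω).trans_le (hstep ω)
        have := Measure.isProbabilityMeasure_map (μ := μ) (hζ (n + 1)).aemeasurable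
        have h1 : StronglyMeasurable fun a => ∫ z, ψ (a, z) ∂(μ.map (ζ (n + 1))) :=
          hψ.stronglyMeasurable.integral_prod_right'
        refine Integrable.mono' (integrable_const M)
          (h1.measurable.comp hSm).aestronglyMeasurable (ae_of_all _ fun ω => ?_)
        have := norm_integral_le_of_norm_le_const (μ := μ.map (ζ (n + 1)))
          (ae_of_all _ fun z => (Real.norm_eq_abs _).trans_le (hM _ : |ψ (S ω, z)| ≤ M))
        simpa using this
    _ = _ := by
        have h1 : Integrable (fun ω => f (S ω).1 - φ (S ω).1) μ := (hbd hf hM).sub (hbd hφ hL)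
        rw [integral_add h1 (integrable_const R), integral_sub (hbd hf hM) (hbd hφ hL),
          integral_const, probReal_univ, one_smul]

/-- The mean of a bounded function of the output is its average over the candidate iterates. -/
theorem integral_output {P : Measure Ξ} (rule : Rule)
    {g : E d → Ξ → ℝ} (hg : Measurable (Function.uncurry g))
    {β : ℝ → ℝ} (hβ : Measurable β) (γ η ν : ℝ) (x₁ : E d) (t₁ : ℝ)
    {ζ : ℕ → Ω → Ξ × E d × E d} {k₀ T : ℕ} {κ : Ω → ℕ} (hS : Sampling P μ ζ k₀ T κ)
    {φ : E d → ℝ} {L : ℝ} (hφ : Measurable φ) (hL : ∀ x, |φ x| ≤ L) :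
    Integrable (fun ω => φ (iterate rule g β γ η ν x₁ t₁ (fun k => ζ k ω) (κ ω))) μ ∧
    ∫ ω, φ (iterate rule g β γ η ν x₁ t₁ (fun k => ζ k ω) (κ ω)) ∂μ
      = ((T - k₀ : ℕ) : ℝ)⁻¹ * ∑ n ∈ Finset.Ico k₀ T,
          ∫ ω, φ (state rule g β γ η ν x₁ t₁ (fun k => ζ k ω) n).1 ∂μ := by
  have hζm : Measurable fun ω k => ζ k ω := measurable_pi_lambda _ hS.measurable
  let ψ : (ℕ → Ξ × E d × E d) × ℕ → ℝ := fun p => φ (iterate rule g β γ η ν x₁ t₁ p.1 p.2)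
  have hψ : Measurable ψ := measurable_from_prod_countable_left fun k =>
    hφ.comp (measurable_state rule hg hβ γ η ν x₁ t₁ (k - 1)).fst
  have hbd : ∀ n, Integrable
      (fun ω => φ (state rule g β γ η ν x₁ t₁ (fun k => ζ k ω) n).1) μ := fun n =>
    Integrable.mono' (integrable_const L)
      (hφ.comp ((measurable_state rule hg hβ γ η ν x₁ t₁ n).comp hζm).fst).aestronglyMeasurable
      (ae_of_all _ fun ω => (Real.norm_eq_abs _).trans_le (hL _))
  constructor
  · exact Integrable.mono' (integrable_const L)
      (hψ.comp (hζm.prodMk hS.measurable_index)).aestronglyMeasurable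
      (ae_of_all _ fun ω => (Real.norm_eq_abs _).trans_le (hL _))
  · have h := integral_comp_indep hζm hS.measurable_index hS.indep_index.symm hψ fun p => hL _
    refine (h.trans ?_)
    simp only [hS.law_index, integral_uniformOn_Icc]
    -- The iterate `x_k` is the state after `k - 1` iterations, so the indices `k₀+1, …, T` become
    -- `k₀, …, T-1`.
    have e : Finset.Icc (k₀ + 1) T = Finset.Ico (k₀ + 1) (T + 1) := by
      ext
      simp
    rw [integral_const_mul, e, Nat.add_sub_add_right]
    simp only [← Finset.sum_Ico_add', ψ, iterate, Nat.add_sub_cancel]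
    rw [integral_finsetSum _ fun n _ => hbd n]

end Iterates

/-! ### Accumulated error over the averaging window -/

theorem errBound_mono {d : ℕ} {L ν t t' : ℝ} (ht : 0 ≤ t) (h : t ≤ t') :
    errBound d L ν t ≤ errBound d L ν t' := by
  have := normalMoment_nonneg 6 (by decide)
  unfold errBound
  gcongr

theorem errBound_nonneg {d : ℕ} {L ν : ℝ} (hν : 0 ≤ ν) (t : ℝ) : 0 ≤ errBound d L ν t := by
  have := normalMoment_nonneg 6 (by decide)
  unfold errBound
  positivity

/-- The square of the maximum is at most the sum of squares: the decaying part is a geometric series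
starting at `γ^(2k₀)`, and the floor contributes `ν` at each index. -/
theorem sum_errBound_le {d : ℕ} {L ν t₁ γ γmax : ℝ} (hd : 0 < d) (hν : 0 ≤ ν) (hγ : 0 < γ)
    (hγm : γ ≤ γmax) (hγ1 : γmax < 1) {k₀ T : ℕ} (hT : k₀ < T) :
    ∑ n ∈ Finset.Ico k₀ T, errBound d L ν (max (γ ^ n * t₁) √ν)
      ≤ 2 * L ^ 2 * normalMoment 6 * t₁ ^ 2 / (1 - γmax) * (d ^ 3 * (γ ^ k₀) ^ 2)
        + ((T : ℝ) - k₀) * ((2 * L ^ 2 * normalMoment 6 + 8) * (d ^ 3 * ν)) := by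
  have hm6 := normalMoment_nonneg 6 (by decide)
  have hd1 : (1 : ℝ) ≤ d := by exact_mod_cast hd
  have hN : (0 : ℝ) ≤ (T : ℝ) - k₀ := by
    rw [sub_nonneg]
    exact_mod_cast hT.le
  have hgeom : ∑ n ∈ Finset.Ico k₀ T, (γ ^ 2) ^ n ≤ (γ ^ k₀) ^ 2 / (1 - γmax) := by
    have hγ2 : γ ^ 2 ≤ γmax := by nlinarith
    refine (geom_sum_Ico_le_of_lt_one (sq_nonneg γ) (by linarith)).trans ?_
    rw [← pow_mul, mul_comm 2, pow_mul]
    have : 0 < 1 - γmax := by linarith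
    gcongr
  have hd3 : (d : ℝ) ≤ d ^ 3 := by
    calc (d : ℝ) = d * 1 := (mul_one _).symm
      _ ≤ d * d ^ 2 := by gcongr; exact one_le_pow₀ hd1
      _ = d ^ 3 := by ring
  have hterm : ∀ n, errBound d L ν (max (γ ^ n * t₁) √ν)
      ≤ 2 * L ^ 2 * normalMoment 6 * t₁ ^ 2 * d ^ 3 * (γ ^ 2) ^ n
        + (2 * L ^ 2 * normalMoment 6 + 8) * (d ^ 3 * ν) := by
    intro n
    have hmax : max (γ ^ n * t₁) √ν ^ 2 ≤ (γ ^ 2) ^ n * t₁ ^ 2 + ν := by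
      rcases max_choice (γ ^ n * t₁) √ν with h | h <;> rw [h]
      · have : (γ ^ n * t₁) ^ 2 = (γ ^ 2) ^ n * t₁ ^ 2 := by ring
        linarith
      · rw [Real.sq_sqrt hν]
        have : 0 ≤ (γ ^ 2) ^ n * t₁ ^ 2 := by positivity
        linarith
    calc errBound d L ν (max (γ ^ n * t₁) √ν)
        ≤ 2 * L ^ 2 * ((γ ^ 2) ^ n * t₁ ^ 2 + ν) * (normalMoment 6 * d ^ 3) + 8 * ν * d ^ 3 := by
          unfold errBound
          gcongr
      _ = _ := by ring
  calc ∑ n ∈ Finset.Ico k₀ T, errBound d L ν (max (γ ^ n * t₁) √ν)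
      ≤ ∑ n ∈ Finset.Ico k₀ T, (2 * L ^ 2 * normalMoment 6 * t₁ ^ 2 * d ^ 3 * (γ ^ 2) ^ n
        + (2 * L ^ 2 * normalMoment 6 + 8) * (d ^ 3 * ν)) := Finset.sum_le_sum fun n _ => hterm n
    _ = 2 * L ^ 2 * normalMoment 6 * t₁ ^ 2 * d ^ 3 * ∑ n ∈ Finset.Ico k₀ T, (γ ^ 2) ^ n
        + ((T : ℝ) - k₀) * ((2 * L ^ 2 * normalMoment 6 + 8) * (d ^ 3 * ν)) := by
      rw [Finset.sum_add_distrib, ← Finset.mul_sum, Finset.sum_const, Nat.card_Ico,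
        nsmul_eq_mul, Nat.cast_sub hT.le]
    _ ≤ 2 * L ^ 2 * normalMoment 6 * t₁ ^ 2 * d ^ 3 * ((γ ^ k₀) ^ 2 / (1 - γmax))
        + ((T : ℝ) - k₀) * ((2 * L ^ 2 * normalMoment 6 + 8) * (d ^ 3 * ν)) := by gcongr
    _ = _ := by ring

theorem sum_le_of_descent {a p R : ℕ → ℝ} {b : ℝ} {k T : ℕ} (hkT : k ≤ T)
    (h : ∀ n, a (n + 1) ≤ a n - b * p n + R n) :
    b * ∑ n ∈ Finset.Ico k T, p n ≤ a k - a T + ∑ n ∈ Finset.Ico k T, R n := by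
  induction T, hkT using Nat.le_induction with
  | base => simp
  | succ T hT ih =>
    rw [Finset.sum_Ico_succ_top hT, Finset.sum_Ico_succ_top hT]
    linarith [h T]

/-! ### Mean square gradient at the output -/

section Output

variable {d : ℕ} {Ξ Ω : Type*} [MeasurableSpace Ξ] [MeasurableSpace Ω] {μ : Measure Ω}
  [IsProbabilityMeasure μ]

/-- Mean square gradient at the output, in terms of the smoothing at the start of the averaging
window and of the error level. -/
theorem integral_output_sq_gradient_le {P : Measure Ξ} [IsProbabilityMeasure P] {rule : Rule}
    {g g' : E d → Ξ → ℝ} {M L₀ L₁ ν B K t₁ γ γmax η : ℝ} {β : ℝ → ℝ} {x₁ : E d}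
    {ζ : ℕ → Ω → Ξ × E d × E d} {k₀ T : ℕ} {κ : Ω → ℕ}
    (hd : 0 < d) (hL₀ : 0 ≤ L₀) (hL₁ : 0 ≤ L₁) (hK : 0 < K)
    (hm : ∀ x, Measurable (g x)) (hM : ∀ x s, |g x s| ≤ M)
    (hlip : ∀ s, IsLip L₀ fun x => g x s) (hs : ∀ s, IsSmooth L₁ fun x => g x s)
    (hg' : Measurable (Function.uncurry g')) (hB : ∀ x s, |g' x s| ≤ B)
    (hgg' : ∀ x s, |g x s - g' x s| ≤ ν) (ht₁ : 0 < t₁) (hν : 0 ≤ ν)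
    (hνr : rule = Rule.derivative → 0 < ν) (hν₁ : √ν ≤ t₁)
    (hγ : 0 < γ) (hγm : γ ≤ γmax) (hγ1 : γmax < 1) (hS : Sampling P μ ζ k₀ T κ) (hT : k₀ < T)
    (hβm : Measurable β)
    (hβ : ∀ t, 0 < t → √ν ≤ t → 1 / (K * √(((T : ℝ) - k₀) * (d + 4))) ≤ β t ∧
      β t ≤ 1 / √(((T : ℝ) - k₀) * (d + 4))) :
    ∫ ω, ‖gradient (meanFn P g)
        (iterate rule g' β γ η ν x₁ t₁ (fun k => ζ k ω) (κ ω))‖ ^ 2 ∂μ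
      ≤ (4 * K * M + 4 * K * L₁ * normalMoment 4 * L₀ ^ 2)
          * (√(((T : ℝ) - k₀) * (d + 4)) / ((T : ℝ) - k₀))
        + (K + 4 * K * L₁) * (2 * L₁ ^ 2 * normalMoment 6 * t₁ ^ 2 / (1 - γmax)
            * (d ^ 3 * (γ ^ k₀) ^ 2 / ((T : ℝ) - k₀))
          + (2 * L₁ ^ 2 * normalMoment 6 + 8) * (d ^ 3 * ν)) := by
  set f := meanFn P g
  set N : ℝ := (T : ℝ) - k₀ with hN
  set D : ℝ := √(N * (d + 4)) with hD
  have hm4 := normalMoment_nonneg 4 (by decide)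
  have hd1 : (1 : ℝ) ≤ d := by exact_mod_cast hd
  have hN1 : 1 ≤ N := by
    have : (k₀ : ℝ) + 1 ≤ T := by exact_mod_cast hT
    linarith
  have hD2 : D ^ 2 = N * (d + 4) := Real.sq_sqrt (by positivity)
  have hD1 : 1 ≤ D := by
    rw [hD, Real.one_le_sqrt]
    nlinarith
  have hfs : IsSmooth L₁ f := isSmooth_meanFn hL₀ hm hM hs hlip
  have hfc : Continuous f := hfs.1.continuous
  have hfM : ∀ x, |f x| ≤ M := abs_meanFn_le hM
  have hfL : ∀ x, ‖gradient f x‖ ≤ L₀ := (isLip_meanFn hm hM hlip).norm_gradient_le hL₀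
  have hgc : Continuous (gradient f) :=
    (LipschitzWith.of_dist_le_mul (K := ⟨L₁, hL₁⟩) fun x y => by
      rw [dist_eq_norm, dist_eq_norm]
      exact hfs.2 x y).continuous
  have hsqm : Measurable fun x => ‖gradient f x‖ ^ 2 := (hgc.norm.pow 2).measurable
  have hsqL : ∀ x, |‖gradient f x‖ ^ 2| ≤ L₀ ^ 2 := fun x => by
    rw [abs_of_nonneg (sq_nonneg _)]
    exact pow_le_pow_left₀ (norm_nonneg _) (hfL x) 2
  set S : ℕ → Ω → E d × ℝ := fun n ω => state rule g' β γ η ν x₁ t₁ (fun k => ζ k ω) n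
  set a : ℕ → ℝ := fun n => ∫ ω, f (S n ω).1 ∂μ with ha
  set p : ℕ → ℝ := fun n => ∫ ω, ‖gradient f (S n ω).1‖ ^ 2 ∂μ with hp
  set err : ℕ → ℝ := fun n => errBound d L₁ ν (max (γ ^ n * t₁) √ν) with herr
  set R : ℕ → ℝ := fun n => 1 / D / 2 * err n
    + L₁ * (1 / D) ^ 2 * (2 * (normalMoment 4 * d * L₀ ^ 2) + 2 * err n) with hR
  have herr0 : ∀ n, 0 ≤ err n := fun n => errBound_nonneg hν _
  -- The step size is bounded below by `1/(KD)` in the gradient term and above by `1/D` in the error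
  -- terms, so the recursion has constant coefficients although `t` is random.
  have hdesc : ∀ n, a (n + 1) ≤ a n - 1 / (2 * K * D) * p n + R n := by
    intro n
    have h := integral_state_succ_le (μ := μ) (P := P) rule hg' hβm (γ := γ) (η := η) (ν := ν)
      (x₁ := x₁) (t₁ := t₁) hS.measurable hS.indep hS.law hfc.measurable
      (φ := fun x => 1 / (2 * K * D) * ‖gradient f x‖ ^ 2) (hsqm.const_mul _) hfM
      (L := 1 / (2 * K * D) * L₀ ^ 2) (fun x => by
        rw [abs_mul, abs_of_pos (by positivity)]
        gcongr
        exact hsqL x) (R := R n) (n := n) (fun ω => by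
        obtain ⟨h1, h2, h3⟩ := state_snd_bounds (rule := rule) (η := η) g' β x₁ (fun k => ζ k ω)
          hγ (hγm.trans hγ1.le) ht₁ hνr hν₁ n
        obtain ⟨h4, h5⟩ := hβ _ h1 h2
        have h0 : 0 ≤ β (state rule g' β γ η ν x₁ t₁ (fun k => ζ k ω) n).2 :=
          le_trans (by positivity) h4
        have hst := integral_step_le (P := P) hd hL₀ hL₁ h0 hm hM hlip hs hg' hB hgg' h1 h2
          (state rule g' β γ η ν x₁ t₁ (fun k => ζ k ω) n).1
        have he := errBound_mono (d := d) (L := L₁) (ν := ν) h1.le h3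
        have he0 := errBound_nonneg (d := d) (L := L₁) hν
          (state rule g' β γ η ν x₁ t₁ (fun k => ζ k ω) n).2
        refine hst.trans ?_
        have e1 : 1 / (2 * K * D) * ‖gradient f
              (state rule g' β γ η ν x₁ t₁ (fun k => ζ k ω) n).1‖ ^ 2
            ≤ β (state rule g' β γ η ν x₁ t₁ (fun k => ζ k ω) n).2 / 2 * ‖gradient f
              (state rule g' β γ η ν x₁ t₁ (fun k => ζ k ω) n).1‖ ^ 2 := by
          have : 1 / (2 * K * D) = 1 / (K * D) / 2 := by
            field_simp
          rw [this]
          gcongr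
        have e2 : β (state rule g' β γ η ν x₁ t₁ (fun k => ζ k ω) n).2 / 2
            * errBound d L₁ ν (state rule g' β γ η ν x₁ t₁ (fun k => ζ k ω) n).2
            ≤ 1 / D / 2 * err n := by
          gcongr
        have e3 : L₁ * β (state rule g' β γ η ν x₁ t₁ (fun k => ζ k ω) n).2 ^ 2
            * (2 * (normalMoment 4 * d * L₀ ^ 2)
              + 2 * errBound d L₁ ν (state rule g' β γ η ν x₁ t₁ (fun k => ζ k ω) n).2)
            ≤ L₁ * (1 / D) ^ 2 * (2 * (normalMoment 4 * d * L₀ ^ 2) + 2 * err n) := by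
          gcongr
        simp only [hR]
        linarith)
    rw [integral_const_mul] at h
    exact h
  have hsum := sum_le_of_descent hT.le hdesc
  -- Boundedness of `f` makes the telescoped difference independent of `x₁`.
  have hab : a k₀ - a T ≤ 2 * M := by
    have h1 : ∀ n, |a n| ≤ M := fun n => by
      have := norm_integral_le_of_norm_le_const (μ := μ)
        (ae_of_all _ fun ω => (Real.norm_eq_abs _).trans_le (hfM (S n ω).1))
      simpa [ha] using this
    have := abs_le.1 (h1 k₀)
    have := abs_le.1 (h1 T)
    linarith
  set W := ∑ n ∈ Finset.Ico k₀ T, err n with hW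
  have hW0 : 0 ≤ W := Finset.sum_nonneg fun n _ => herr0 n
  have hRsum : ∑ n ∈ Finset.Ico k₀ T, R n = 1 / D / 2 * W
      + L₁ * (1 / D) ^ 2 * (N * (2 * (normalMoment 4 * d * L₀ ^ 2)) + 2 * W) := by
    simp only [hR, Finset.sum_add_distrib, ← Finset.mul_sum, Finset.sum_const, Nat.card_Ico,
      nsmul_eq_mul, Nat.cast_sub hT.le]
    ring
  have hWle := sum_errBound_le (L := L₁) (t₁ := t₁) hd hν hγ hγm hγ1 hT
  have hout := (integral_output (P := P) rule hg' hβm γ η ν x₁ t₁ hS hsqm hsqL).2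
  rw [hout, Nat.cast_sub hT.le]
  have key : N⁻¹ * ∑ n ∈ Finset.Ico k₀ T, p n
      ≤ (4 * K * M + 4 * K * L₁ * normalMoment 4 * L₀ ^ 2) * (D / N)
        + (K + 4 * K * L₁) * (W / N) := by
    have h1 : ∑ n ∈ Finset.Ico k₀ T, p n ≤ 2 * K * D * (2 * M + (1 / D / 2 * W
        + L₁ * (1 / D) ^ 2 * (N * (2 * (normalMoment 4 * d * L₀ ^ 2)) + 2 * W))) := by
      have h2 := mul_le_mul_of_nonneg_left (hsum.trans (add_le_add hab hRsum.le))
        (by positivity : 0 ≤ 2 * K * D)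
      have h3 : 2 * K * D * (1 / (2 * K * D) * ∑ n ∈ Finset.Ico k₀ T, p n)
          = ∑ n ∈ Finset.Ico k₀ T, p n := by
        field_simp
      rwa [h3] at h2
    have h4 : 2 * K * D * (2 * M + (1 / D / 2 * W
        + L₁ * (1 / D) ^ 2 * (N * (2 * (normalMoment 4 * d * L₀ ^ 2)) + 2 * W)))
        = 4 * K * M * D + K * W + 4 * K * L₁ * normalMoment 4 * L₀ ^ 2 * (N * d / D)
          + 4 * K * L₁ * (W / D) := by
      field_simp
      ring
    -- The `N` quadratic terms, each of size `d/D²`, are balanced by the step size: after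
    -- multiplication by `D` they cost no more than the telescoped term.
    have h5 : N * d / D ≤ D := by
      rw [div_le_iff₀ (by positivity), ← sq, hD2]
      gcongr
      linarith
    have h6 : W / D ≤ W := div_le_self hW0 hD1
    calc N⁻¹ * ∑ n ∈ Finset.Ico k₀ T, p n
        ≤ N⁻¹ * (4 * K * M * D + K * W + 4 * K * L₁ * normalMoment 4 * L₀ ^ 2 * D
          + 4 * K * L₁ * W) := by
          gcongr
          refine (h1.trans_eq h4).trans ?_
          gcongr
      _ = _ := by
          field_simp
          ring
  refine key.trans ?_
  gcongr
  rw [div_le_iff₀ (by positivity)]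
  rw [← hN] at hWle
  refine hWle.trans_eq ?_
  have hγ1' : 1 - γmax ≠ 0 := by linarith
  field_simp

end Output

/-! ### Step size, burn-in decay and smoothness of the accessible objective -/

/-- Once `N ≥ d + 4`, also `√(N(d+4)) ≥ d + 4`, so the smoothness branch of the minimum costs at
most the factor `16Λ`. -/
theorem stepSize_bounds {d : ℕ} {ℓ Λ N : ℝ} (hΛ : 1 ≤ Λ) (hℓ : ℓ ≤ Λ) (hN : (d : ℝ) + 4 ≤ N) :
    1 / (16 * Λ * √(N * (d + 4))) ≤ stepSize d ℓ N ∧ stepSize d ℓ N ≤ 1 / √(N * (d + 4)) := by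
  have hN0 : 0 < N := lt_of_lt_of_le (by positivity) hN
  have h0 : 0 < √(N * (d + 4)) := by positivity
  have h1 : (d : ℝ) + 4 ≤ √(N * (d + 4)) := by
    refine Real.le_sqrt_of_sq_le ?_
    rw [sq]
    gcongr
  refine ⟨?_, one_div_le_one_div_of_le h0 (le_max_right _ _)⟩
  refine one_div_le_one_div_of_le (lt_max_of_lt_right h0) (max_le ?_ ?_)
  · calc 16 * ((d : ℝ) + 4) * ℓ ≤ 16 * (d + 4) * Λ := by gcongr
      _ ≤ 16 * √(N * (d + 4)) * Λ := by gcongr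
      _ = _ := by ring
  · nlinarith

theorem pow_le_inv_of_logb_le {γ : ℝ} {d k : ℕ} (hd : 0 < d) (hγ : 0 < γ) (hγ1 : γ < 1)
    (h : Real.logb γ (1 / d) ≤ k) : γ ^ k ≤ 1 / d := by
  have hd' : (0 : ℝ) < 1 / d := by positivity
  calc γ ^ k = γ ^ (k : ℝ) := (Real.rpow_natCast _ _).symm
    _ ≤ γ ^ Real.logb γ (1 / d) := Real.rpow_le_rpow_of_exponent_ge hγ hγ1.le h
    _ = 1 / d := Real.rpow_logb hγ hγ1.ne hd'

/-- The exponents `bε⁴/d` and `k ≥ a d/ε⁴` multiply to at least `ba ≥ 1`. -/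
theorem pow_le_inv_of_le_rpow {γ a b ε : ℝ} {d k : ℕ} (hd : 0 < d) (hγ : 0 < γ) (hε : 0 < ε)
    (hb : 0 < b) (hab : 1 ≤ b * a) (h : γ ≤ (d : ℝ) ^ (-(b * (ε ^ 4 / d))))
    (hk : a * (d / ε ^ 4) ≤ k) : γ ^ k ≤ 1 / d := by
  have hd1 : (1 : ℝ) ≤ d := by exact_mod_cast hd
  have hd0 : (0 : ℝ) < d := by positivity
  calc γ ^ k ≤ ((d : ℝ) ^ (-(b * (ε ^ 4 / d)))) ^ k := by gcongr
    _ = (d : ℝ) ^ (-(b * (ε ^ 4 / d)) * k) := by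
      rw [Real.rpow_mul hd0.le, Real.rpow_natCast]
    _ ≤ (d : ℝ) ^ (-1 : ℝ) := by
      refine Real.rpow_le_rpow_of_exponent_le hd1 ?_
      have h1 : b * (ε ^ 4 / d) * (a * (d / ε ^ 4)) ≤ b * (ε ^ 4 / d) * k := by gcongr
      have h2 : b * (ε ^ 4 / d) * (a * (d / ε ^ 4)) = b * a := by
        field_simp
      linarith
    _ = 1 / d := by rw [Real.rpow_neg_one, one_div]

/-- The accessible mean is `f + h` with `|h| ≤ ν`. Smoothing preserves the constant `L₁` of `f`, and
makes `h` smooth with constant `2ν/t²`. -/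
theorem gradLip_smoothed_le {d : ℕ} {Ξ : Type*} [MeasurableSpace Ξ] {P : Measure Ξ}
    [IsProbabilityMeasure P] {g g' : E d → Ξ → ℝ} {M L₀ L₁ ν t : ℝ} (hL₀ : 0 ≤ L₀)
    (hL₁ : 0 ≤ L₁) (hm : ∀ x, Measurable (g x)) (hM : ∀ x s, |g x s| ≤ M)
    (hlip : ∀ s, IsLip L₀ fun x => g x s) (hs : ∀ s, IsSmooth L₁ fun x => g x s)
    (hg' : Measurable (Function.uncurry g')) (hgg' : ∀ x s, |g x s - g' x s| ≤ ν) (hν : 0 ≤ ν)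
    (ht : 0 < t) :
    gradLip (fun x => smoothed (meanFn P g') x t) ≤ L₁ + 2 * ν / t ^ 2 := by
  set f := meanFn P g with hf
  have hfs : IsSmooth L₁ f := isSmooth_meanFn hL₀ hm hM hs hlip
  have hfl : IsLip L₀ f := isLip_meanFn hm hM hlip
  have hfc : Continuous f := hfs.1.continuous
  have hfM : ∀ x, |f x| ≤ M := abs_meanFn_le hM
  have hf'm : Measurable (meanFn P g') := measurable_meanFn hg'
  set h : E d → ℝ := fun x => meanFn P g' x - f x with hh
  have hhm : Measurable h := hf'm.sub hfc.measurable
  have hB : ∀ x s, |g' x s| ≤ M + ν := fun x s => by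
    have h1 := abs_le.1 (hM x s)
    have h2 := abs_le.1 (hgg' x s)
    rw [abs_le]
    constructor <;> linarith
  have hhν : ∀ x, |h x| ≤ ν := by
    intro x
    have hi : Integrable (g' x) P := Integrable.mono' (integrable_const (M + ν))
      (hg'.comp (g := Function.uncurry g') (f := fun s => (x, s)) (by fun_prop)).aestronglyMeasurable
      (ae_of_all _ fun s => (Real.norm_eq_abs _).trans_le (hB x s))
    have hig : Integrable (g x) P := Integrable.mono' (integrable_const M)
      (hm x).aestronglyMeasurable (ae_of_all _ fun s => (Real.norm_eq_abs _).trans_le (hM x s))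
    rw [hh, hf]
    simp only [meanFn]
    rw [← integral_sub hi hig]
    have := norm_integral_le_of_norm_le_const (μ := P)
      (ae_of_all _ fun s => (Real.norm_eq_abs _).trans_le
        ((abs_sub_comm (g' x s) (g x s)).trans_le (hgg' x s)))
    simpa using this
  have hsf : IsSmooth L₁ (fun x => smoothed f x t) := by
    -- Smoothing is itself a mean, with the Gaussian direction as the sample.
    refine isSmooth_meanFn (P := gauss d) (g := fun x u => f (x + t • u)) hL₀
      (fun x => hfc.measurable.comp (by fun_prop)) (fun x u => hfM _) (fun u => ?_) fun u x y => ?_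
    · refine ⟨hfs.1.comp (differentiable_id.add_const _), fun x y => ?_⟩
      have e : ∀ x, gradient (fun x => f (x + t • u)) x = gradient f (x + t • u) := fun x => by
        rw [gradient, fderiv_comp_add_right, gradient]
      rw [e, e]
      simpa using hfs.2 (x + t • u) (y + t • u)
    · simpa using hfl (x + t • u) (y + t • u)
  have e : (fun x => smoothed (meanFn P g') x t) = fun x => smoothed f x t + smoothed h x t := by
    funext x
    have hi1 : Integrable (fun u => f (x + t • u)) (gauss d) :=
      Integrable.mono' (integrable_const M)
        (hfc.measurable.comp (by fun_prop : Measurable fun u => x + t • u)).aestronglyMeasurable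
        (ae_of_all _ fun u => (Real.norm_eq_abs _).trans_le (hfM _))
    have hi2 : Integrable (fun u => h (x + t • u)) (gauss d) :=
      Integrable.mono' (integrable_const ν)
        (hhm.comp (by fun_prop : Measurable fun u => x + t • u)).aestronglyMeasurable
        (ae_of_all _ fun u => (Real.norm_eq_abs _).trans_le (hhν _))
    simp only [smoothed]
    rw [← integral_add hi1 hi2]
    simp [hh]
  rw [e]
  exact gradLip_le (by positivity) (hsf.add (isSmooth_smoothed hhm hhν ht))

section Regular

variable {d : ℕ} {Ξ : Type*} [MeasurableSpace Ξ] {M L₀ L₁ t₁ : ℝ} {f : E d → ℝ}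
  {g : E d → Ξ → ℝ}

/-- At smoothing parameter `0` the Gaussian average is the value itself. -/
theorem RegularObjective.abs_le (h : RegularObjective M L₀ L₁ t₁ f g) (ht₁ : 0 ≤ t₁)
    (x : E d) (s : Ξ) : |g x s| ≤ M := by
  simpa using h.bounded 0 ⟨le_rfl, ht₁⟩ x s

theorem RegularObjective.nonneg [Nonempty Ξ] (h : RegularObjective M L₀ L₁ t₁ f g)
    (hd : 0 < d) (ht₁ : 0 ≤ t₁) : 0 ≤ M ∧ 0 ≤ L₀ ∧ 0 ≤ L₁ := by
  obtain ⟨s⟩ := ‹Nonempty Ξ›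
  have hlip := h.lip s (EuclideanSpace.single ⟨0, hd⟩ 1) 0
  have hsm := (h.smooth s).2 (EuclideanSpace.single ⟨0, hd⟩ 1) 0
  simp only [sub_zero, PiLp.norm_single, norm_one, mul_one] at hlip hsm
  exact ⟨(abs_nonneg _).trans (h.abs_le ht₁ 0 s), (abs_nonneg _).trans hlip,
    (norm_nonneg _).trans hsm⟩

end Regular

/-- A mean square bound on the gradient at the output gives the tolerance. -/
theorem ReachesTolerance.of_sq {d : ℕ} {Ω : Type*} [MeasurableSpace Ω] {μ : Measure Ω}
    [IsProbabilityMeasure μ] {f : E d → ℝ} {xhat : Ω → E d} {ε : ℝ} (hε : 0 < ε)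
    (h1 : Integrable (fun ω => ‖gradient f (xhat ω)‖) μ)
    (h2 : Integrable (fun ω => ‖gradient f (xhat ω)‖ ^ 2) μ)
    (h : ∫ ω, ‖gradient f (xhat ω)‖ ^ 2 ∂μ ≤ ε ^ 2) : ReachesTolerance μ f xhat ε := by
  refine ⟨h1, ?_⟩
  -- Young's inequality `s ≤ s²/(2ε) + ε/2` in place of Jensen.
  calc ∫ ω, ‖gradient f (xhat ω)‖ ∂μ
      ≤ ∫ ω, (‖gradient f (xhat ω)‖ ^ 2 * (1 / (2 * ε)) + ε / 2) ∂μ := by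
        refine integral_mono h1 ((h2.mul_const _).add (integrable_const _)) fun ω => ?_
        have e : ‖gradient f (xhat ω)‖ ^ 2 * (1 / (2 * ε)) + ε / 2 - ‖gradient f (xhat ω)‖
            = (‖gradient f (xhat ω)‖ - ε) ^ 2 * (1 / (2 * ε)) := by
          field_simp
          ring
        have : 0 ≤ (‖gradient f (xhat ω)‖ - ε) ^ 2 * (1 / (2 * ε)) := by positivity
        simp only
        linarith
    _ = (∫ ω, ‖gradient f (xhat ω)‖ ^ 2 ∂μ) * (1 / (2 * ε)) + ε / 2 := by
        rw [integral_add (h2.mul_const _) (integrable_const _), integral_mul_const,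
          integral_const, probReal_univ, one_smul]
    _ ≤ ε ^ 2 * (1 / (2 * ε)) + ε / 2 := by gcongr
    _ = ε := by
        field_simp
        ring

/-- Since `d + 4 ≤ 5d`, squaring leaves the constant `45 = 5 · 3²`. -/
theorem sqrt_div_le {c₁ C₀ N ε : ℝ} {d : ℕ} (hd : 0 < d) (hε : 0 < ε)
    (hC₀ : 0 < C₀) (hC : 45 * c₁ ^ 2 ≤ C₀) (hN : C₀ * (d / ε ^ 4) ≤ N) :
    c₁ * (√(N * (d + 4)) / N) ≤ ε ^ 2 / 3 := by
  have hd1 : (1 : ℝ) ≤ d := by exact_mod_cast hd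
  have hN0 : 0 < N := lt_of_lt_of_le (by positivity) hN
  have h1 : 45 * c₁ ^ 2 * d ≤ N * ε ^ 4 := by
    have h2 := mul_le_mul_of_nonneg_right hN (by positivity : 0 ≤ ε ^ 4)
    have h3 : C₀ * (d / ε ^ 4) * ε ^ 4 = C₀ * d := by field_simp
    rw [h3] at h2
    exact (by gcongr : 45 * c₁ ^ 2 * d ≤ C₀ * d).trans h2
  have h2 : √(N * (d + 4)) * (3 * c₁) ≤ N * ε ^ 2 := by
    refine abs_le_of_sq_le_sq' ?_ (by positivity) |>.2
    rw [mul_pow, Real.sq_sqrt (by positivity)]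
    calc N * (d + 4) * (3 * c₁) ^ 2 ≤ N * (5 * d) * (3 * c₁) ^ 2 := by
          gcongr
          linarith
      _ = N * (45 * c₁ ^ 2 * d) := by ring
      _ ≤ N * (N * ε ^ 4) := by gcongr
      _ = (N * ε ^ 2) ^ 2 := by ring
  rw [← mul_div_assoc, div_le_iff₀ hN0]
  linarith

end ZOSLGH

/-! ### The theorem -/

theorem theoremC2
    -- problem constants: bound on the objective, Lipschitz and smoothness constants, variance,
    -- initial smoothing parameter, upper bound on the decreasing factor
    (M L₀ L₁ σ t₁ γmax : ℝ) (ht₁ : 0 < t₁) (hγmax : γmax < 1)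
    -- the constants of `k₁ = Θ(d/ε⁴)` and of `γ ≤ d^{-Ω(ε⁴/d)}`
    (a₁ a₂ b : ℝ) (ha₁ : 0 < a₁) (hb : 0 < b) :
    ∃ c : ℝ, 0 < c ∧ ∃ C : ℝ, 0 < C ∧
      ∀ (d : ℕ) (_ : 0 < d)
        (Ξ : Type*) [MeasurableSpace Ξ] (P : Measure Ξ) [IsProbabilityMeasure P]
        (f : ZOSLGH.E d → ℝ) (fbar fbar' : ZOSLGH.E d → Ξ → ℝ)
        (ε ν γ η : ℝ) (rule : ZOSLGH.Rule) (x₁ : ZOSLGH.E d) (k₁ k₂ T : ℕ) (L₁' : ℝ → ℝ)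
        (Ω : Type*) [MeasurableSpace Ω] (μ : Measure Ω) [IsProbabilityMeasure μ]
        (ζ : ℕ → Ω → Ξ × ZOSLGH.E d × ZOSLGH.E d) (κ : Ω → ℕ),
        ZOSLGH.RegularObjective M L₀ L₁ t₁ f fbar →
        ZOSLGH.StochasticOracle P σ f fbar →
        ZOSLGH.ErrorBound ν fbar fbar' →
        0 < ε →
        0 ≤ ν → (rule = ZOSLGH.Rule.derivative → 0 < ν) → ν ≤ c * (ε ^ 2 / d ^ 3) →
        0 < γ → γ ≤ γmax →
        a₁ * (d / ε ^ 4) ≤ k₁ → k₁ ≤ a₂ * (d / ε ^ 4) →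
        -- `L₁'(t)`: the gradient-Lipschitz constant of `F'(·, t)`, or the explicit bound
        -- `L₁ + 2ν/t²` for it, or anything between the two
        Measurable L₁' →
        (∀ t > 0, L₁' t ∈
          Set.uIcc (ZOSLGH.gradLip (fun x => ZOSLGH.smoothed (ZOSLGH.meanFn P fbar') x t))
            (L₁ + 2 * ν / t ^ 2)) →
        ZOSLGH.Sampling P μ ζ (min k₁ k₂) T κ →
        let β : ℝ → ℝ := fun t => ZOSLGH.stepSize d (L₁' t) ((T : ℝ) - (min k₁ k₂ : ℕ))
        let xhat : Ω → ZOSLGH.E d := fun ω =>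
          ZOSLGH.iterate rule fbar' β γ η ν x₁ t₁ (fun k => ζ k ω) (κ ω)
        (C * (d ^ 2 / ε ^ 4 + d ^ 3 / ε ^ 2) ≤ T →
            ZOSLGH.ReachesTolerance μ f xhat ε) ∧
        -- `k₂` is a multiple at least one of `log_γ (1/d)`, rounded up
        (1 ≤ b * a₁ → γ ≤ (d : ℝ) ^ (-(b * (ε ^ 4 / d))) → Real.logb γ (1 / d) ≤ k₂ →
          C * (d / ε ^ 4) ≤ T →
            ZOSLGH.ReachesTolerance μ f xhat ε) := by
  -- If one of these constants is negative, no objective satisfies the assumptions and any `c`, `C`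
  -- will do.
  by_cases hpos : 0 ≤ M ∧ 0 ≤ L₀ ∧ 0 ≤ L₁
  swap
  · refine ⟨1, one_pos, 1, one_pos, ?_⟩
    intro d hd Ξ _ P _ f fbar fbar' ε ν γ η rule x₁ k₁ k₂ T L₁' Ω _ μ _ ζ κ hreg
    have := P.nonempty_of_neZero
    exact absurd (hreg.nonneg hd ht₁.le) hpos
  obtain ⟨hM0, hL₀, hL₁⟩ := hpos
  have hm4 := ZOSLGH.normalMoment_nonneg 4 (by decide)
  have hm6 := ZOSLGH.normalMoment_nonneg 6 (by decide)
  have hγ1 : 0 < 1 - γmax := by linarith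
  -- From `stepSize_bounds` with `Λ = L₁ + 2`, since `2ν/t² ≤ 2` when `√ν ≤ t`.
  let K := 16 * (L₁ + 2)
  let c₁ := 4 * K * M + 4 * K * L₁ * ZOSLGH.normalMoment 4 * L₀ ^ 2
  let c₂ := K + 4 * K * L₁
  let A₁ := 2 * L₁ ^ 2 * ZOSLGH.normalMoment 6 * t₁ ^ 2 / (1 - γmax)
  let A₂ := 2 * L₁ ^ 2 * ZOSLGH.normalMoment 6 + 8
  -- The summands give, in order, positivity, `N ≥ d + 4`, and a share `ε²/3` each for the `√(d/N)`
  -- term and for the decaying smoothing term.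
  let C₀ := 1 + 5 * L₀ ^ 4 + 45 * c₁ ^ 2 + 3 * (c₂ * A₁ * (1 + L₀ ^ 2))
  have hK : 0 < K := by positivity
  have hc₁ : 0 ≤ c₁ := by positivity
  have hc₂ : 0 ≤ c₂ := by positivity
  have hA₁ : 0 ≤ A₁ := by positivity
  have hA₂ : 0 ≤ A₂ := by positivity
  have hC₀ : 0 < C₀ := by positivity
  obtain ⟨hC1, hC2, hC3⟩ : 5 * L₀ ^ 4 ≤ C₀ ∧ 45 * c₁ ^ 2 ≤ C₀ ∧
      3 * (c₂ * A₁ * (1 + L₀ ^ 2)) ≤ C₀ := by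
    have h1 : 0 ≤ 5 * L₀ ^ 4 := by positivity
    have h2 : 0 ≤ 45 * c₁ ^ 2 := by positivity
    have h3 : 0 ≤ 3 * (c₂ * A₁ * (1 + L₀ ^ 2)) := by positivity
    refine ⟨?_, ?_, ?_⟩ <;> simp only [C₀] <;> linarith only [h1, h2, h3]
  clear_value C₀
  -- The first bound on `c` gives `√ν ≤ t₁`, the second a share `ε²/3` for the `d³ν` term. The
  -- summand `|a₂|` of `C` pays for the burn-in, as `k₀ ≤ k₁ ≤ a₂ d/ε⁴`.
  refine ⟨min (t₁ ^ 2 / (L₀ ^ 2 + 1)) (1 / (3 * (c₂ * A₂) + 1)), by positivity,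
    C₀ + |a₂|, by positivity, ?_⟩
  intro d hd Ξ _ P _ f fbar fbar' ε ν γ η rule x₁ k₁ k₂ T L₁' Ω _ μ _ ζ κ hreg hor herr hε hν hνr
    hνc hγ hγm hk₁ hk₁' hL₁'m hL₁' hS β xhat
  have hd1 : (1 : ℝ) ≤ d := by exact_mod_cast hd
  have hd3 : (1 : ℝ) ≤ d ^ 3 := one_le_pow₀ hd1
  obtain rfl : f = ZOSLGH.meanFn P fbar := funext hor.unbiased
  have hM := hreg.abs_le ht₁.le
  have hB : ∀ x s, |fbar' x s| ≤ M + ν := fun x s => by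
    have h1 := abs_le.1 (hM x s)
    have h2 := abs_le.1 (herr.close x s)
    rw [abs_le]
    constructor <;> linarith
  have hfs := ZOSLGH.isSmooth_meanFn (P := P) hL₀ hreg.measurable hM hreg.smooth hreg.lip
  have hfL := (ZOSLGH.isLip_meanFn (P := P) hreg.measurable hM hreg.lip).norm_gradient_le hL₀
  have hgc : Continuous (gradient (ZOSLGH.meanFn P fbar)) :=
    (LipschitzWith.of_dist_le_mul (K := ⟨L₁, hL₁⟩) fun x y => by
      rw [dist_eq_norm, dist_eq_norm]
      exact hfs.2 x y).continuous
  have hβm : Measurable β := by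
    have h1 := (((hL₁'m.const_mul (16 * ((d : ℝ) + 4))).max
      (measurable_const (a := √(((T : ℝ) - (min k₁ k₂ : ℕ)) * (d + 4))))).const_div 1)
    exact h1
  have hi1 := (ZOSLGH.integral_output (P := P) rule herr.measurable hβm γ η ν x₁ t₁ hS
    hgc.norm.measurable (L := L₀) fun x => (abs_of_nonneg (norm_nonneg _)).trans_le (hfL x)).1
  have hi2 := (ZOSLGH.integral_output (P := P) rule herr.measurable hβm γ η ν x₁ t₁ hS
    (hgc.norm.pow 2).measurable (L := L₀ ^ 2) fun x => by
      rw [abs_of_nonneg (sq_nonneg _)]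
      exact pow_le_pow_left₀ (norm_nonneg _) (hfL x) 2).1
  -- When `L₀ ≤ ε` every point meets the tolerance. Otherwise powers of `ε` are bounded by powers of
  -- `L₀`, which makes the constants uniform for large `ε`.
  rcases le_total L₀ ε with hLε | hεL
  · have : ZOSLGH.ReachesTolerance μ (ZOSLGH.meanFn P fbar) xhat ε := by
      refine ⟨hi1, (integral_mono hi1 (integrable_const ε) fun ω => (hfL _).trans hLε).trans ?_⟩
      simp
    exact ⟨fun _ => this, fun _ _ _ _ => this⟩
  have hε2 : ε ^ 2 ≤ L₀ ^ 2 := pow_le_pow_left₀ hε.le hεL 2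
  have hε4 : ε ^ 4 ≤ L₀ ^ 4 := pow_le_pow_left₀ hε.le hεL 4
  have hν₁ : √ν ≤ t₁ := by
    refine Real.sqrt_le_iff.2 ⟨ht₁.le, hνc.trans ?_⟩
    calc _ ≤ t₁ ^ 2 / (L₀ ^ 2 + 1) * (ε ^ 2 / 1) := by
          gcongr
          exact min_le_left _ _
      _ ≤ t₁ ^ 2 / (L₀ ^ 2 + 1) * (L₀ ^ 2 + 1) := by
          rw [div_one]
          gcongr
          exact hε2.trans (le_add_of_nonneg_right zero_le_one)
      _ = t₁ ^ 2 := by field_simp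
  have hνd : c₂ * A₂ * (d ^ 3 * ν) ≤ ε ^ 2 / 3 := by
    have h1 : d ^ 3 * ν ≤ 1 / (3 * (c₂ * A₂) + 1) * ε ^ 2 := by
      calc d ^ 3 * ν ≤ d ^ 3 * (1 / (3 * (c₂ * A₂) + 1) * (ε ^ 2 / d ^ 3)) := by
            gcongr
            refine hνc.trans ?_
            gcongr
            exact min_le_right _ _
        _ = _ := by field_simp
    calc c₂ * A₂ * (d ^ 3 * ν) ≤ c₂ * A₂ * (1 / (3 * (c₂ * A₂) + 1) * ε ^ 2) := by gcongr
      _ = (3 * (c₂ * A₂)) / (3 * (c₂ * A₂) + 1) * (ε ^ 2 / 3) := by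
          field_simp
      _ ≤ 1 * (ε ^ 2 / 3) := by
          gcongr
          rw [div_le_one (by positivity)]
          exact le_add_of_nonneg_right zero_le_one
      _ = ε ^ 2 / 3 := one_mul _
  -- Both regimes reduce to two conditions on the window length. In the factor `1 + L₀²`, the `1`
  -- serves the first regime and the `L₀²` serves the second, through `ε⁴ ≤ L₀² ε²`.
  have main : ∀ N : ℝ, N = (T : ℝ) - (min k₁ k₂ : ℕ) → C₀ * (d / ε ^ 4) ≤ N →
      C₀ * (d ^ 3 * (γ ^ min k₁ k₂) ^ 2) ≤ (1 + L₀ ^ 2) * ε ^ 2 * N →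
      ZOSLGH.ReachesTolerance μ (ZOSLGH.meanFn P fbar) xhat ε := by
    intro N hN hN1 hN2
    have hdN : (d : ℝ) + 4 ≤ N := by
      calc (d : ℝ) + 4 ≤ 5 * d := by linarith only [hd1]
        _ = 5 * ε ^ 4 * (d / ε ^ 4) := by field_simp
        _ ≤ C₀ * (d / ε ^ 4) := by
          gcongr
          calc 5 * ε ^ 4 ≤ 5 * L₀ ^ 4 := by gcongr
            _ ≤ C₀ := hC1
        _ ≤ N := hN1
    have hN0 : 0 < N := lt_of_lt_of_le (by positivity) hdN
    have hT : min k₁ k₂ < T := by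
      rw [hN, sub_pos] at hN0
      exact_mod_cast hN0
    have hβb : ∀ t, 0 < t → √ν ≤ t → 1 / (K * √(((T : ℝ) - (min k₁ k₂ : ℕ)) * (d + 4))) ≤ β t ∧
        β t ≤ 1 / √(((T : ℝ) - (min k₁ k₂ : ℕ)) * (d + 4)) := by
      intro t ht hνt
      refine ZOSLGH.stepSize_bounds (Λ := L₁ + 2) (by linarith) ?_ (hN ▸ hdN)
      have h1 := ZOSLGH.gradLip_smoothed_le (P := P) hL₀ hL₁ hreg.measurable hM hreg.lip
        hreg.smooth herr.measurable herr.close hν ht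
      -- The unordered interval is harmless: the least constant never exceeds the explicit one, so
      -- the latter bounds both cases.
      have h2 := (Set.mem_uIcc.1 (hL₁' t ht)).elim (fun h => h.2) fun h => h.2.trans h1
      have h3 : 2 * ν / t ^ 2 ≤ 2 := by
        rw [div_le_iff₀ (by positivity)]
        have := (Real.sqrt_le_iff.1 hνt).2
        linarith only [this]
      linarith only [h2, h3]
    refine ZOSLGH.ReachesTolerance.of_sq hε hi1 hi2 ?_
    have h := ZOSLGH.integral_output_sq_gradient_le (P := P) (η := η) (x₁ := x₁) hd hL₀ hL₁ hK
      hreg.measurable hM hreg.lip hreg.smooth herr.measurable hB herr.close ht₁ hν hνr hν₁ hγ hγm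
      hγmax hS hT hβm hβb
    rw [← hN] at h
    refine h.trans ?_
    have e1 : c₁ * (√(N * (d + 4)) / N) ≤ ε ^ 2 / 3 := ZOSLGH.sqrt_div_le hd hε hC₀ hC2 hN1
    have e2 : c₂ * A₁ * (d ^ 3 * (γ ^ min k₁ k₂) ^ 2 / N) ≤ ε ^ 2 / 3 := by
      have h1 : d ^ 3 * (γ ^ min k₁ k₂) ^ 2 / N ≤ (1 + L₀ ^ 2) * ε ^ 2 / C₀ := by
        rw [div_le_div_iff₀ hN0 hC₀]
        linarith only [hN2]
      calc c₂ * A₁ * (d ^ 3 * (γ ^ min k₁ k₂) ^ 2 / N)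
          ≤ c₂ * A₁ * ((1 + L₀ ^ 2) * ε ^ 2 / C₀) := by gcongr
        _ = (3 * (c₂ * A₁ * (1 + L₀ ^ 2))) / C₀ * (ε ^ 2 / 3) := by
          field_simp
        _ ≤ 1 * (ε ^ 2 / 3) := by
          gcongr
          rwa [div_le_one hC₀]
        _ = ε ^ 2 / 3 := one_mul _
    calc _ = c₁ * (√(N * (d + 4)) / N) + c₂ * A₁ * (d ^ 3 * (γ ^ min k₁ k₂) ^ 2 / N)
          + c₂ * A₂ * (d ^ 3 * ν) := by
          simp only [c₁, c₂, A₁, A₂]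
          ring
      _ ≤ ε ^ 2 := by linarith only [e1, e2, hνd]
  have hk₀ : ((min k₁ k₂ : ℕ) : ℝ) ≤ |a₂| * (d / ε ^ 4) := by
    calc ((min k₁ k₂ : ℕ) : ℝ) ≤ k₁ := by exact_mod_cast min_le_left _ _
      _ ≤ a₂ * (d / ε ^ 4) := hk₁'
      _ ≤ |a₂| * (d / ε ^ 4) := by
        gcongr
        exact le_abs_self _
  constructor
  · intro hT
    have h1 : (d : ℝ) / ε ^ 4 ≤ d ^ 2 / ε ^ 4 := by
      gcongr
      nlinarith
    have h2 : (C₀ + |a₂|) * (d / ε ^ 4 + d ^ 3 / ε ^ 2) ≤ T :=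
      le_trans (by gcongr) hT
    have h3 : 0 ≤ C₀ * (d / ε ^ 4) := by positivity
    have h4 : 0 ≤ C₀ * (d ^ 3 / ε ^ 2) := by positivity
    have h5 : 0 ≤ |a₂| * (d ^ 3 / ε ^ 2) := by positivity
    rw [add_mul, mul_add, mul_add] at h2
    have h8 : C₀ * (d / ε ^ 4) ≤ (T : ℝ) - (min k₁ k₂ : ℕ) := by linarith only [h2, h4, h5, hk₀]
    refine main _ rfl h8 ?_
    have h6 : C₀ * (d ^ 3 / ε ^ 2) ≤ (T : ℝ) - (min k₁ k₂ : ℕ) := by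
      linarith only [h2, h3, h5, hk₀]
    have h7 : (γ ^ min k₁ k₂) ^ 2 ≤ 1 :=
      pow_le_one₀ (by positivity) (pow_le_one₀ hγ.le (hγm.trans hγmax.le))
    calc C₀ * (d ^ 3 * (γ ^ min k₁ k₂) ^ 2) ≤ C₀ * (d ^ 3 * 1) := by gcongr
      _ = 1 * ε ^ 2 * (C₀ * (d ^ 3 / ε ^ 2)) := by field_simp
      _ ≤ (1 + L₀ ^ 2) * ε ^ 2 * ((T : ℝ) - (min k₁ k₂ : ℕ)) := by
        gcongr
        exact le_add_of_nonneg_right (sq_nonneg _)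
  · intro hba hγd hk₂ hT
    have h1 : C₀ * (d / ε ^ 4) ≤ (T : ℝ) - (min k₁ k₂ : ℕ) := by
      rw [add_mul] at hT
      linarith only [hT, hk₀]
    refine main _ rfl h1 ?_
    have h2 : γ ^ min k₁ k₂ ≤ 1 / d := by
      -- Whichever of `k₁`, `k₂` ends the burn-in, the decay has reached `1/d`, so `d³γ^(2k₀) ≤ d`.
      rcases min_choice k₁ k₂ with h | h <;> rw [h]
      · exact ZOSLGH.pow_le_inv_of_le_rpow hd hγ hε hb hba hγd hk₁
      · exact ZOSLGH.pow_le_inv_of_logb_le hd hγ (hγm.trans_lt hγmax) hk₂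
    calc C₀ * (d ^ 3 * (γ ^ min k₁ k₂) ^ 2) ≤ C₀ * (d ^ 3 * (1 / d) ^ 2) := by gcongr
      _ = ε ^ 2 * ε ^ 2 * (C₀ * (d / ε ^ 4)) := by field_simp
      _ ≤ (1 + L₀ ^ 2) * ε ^ 2 * ((T : ℝ) - (min k₁ k₂ : ℕ)) := by
        gcongr
        exact hε2.trans (le_add_of_nonneg_left zero_le_one)
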